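/- Let $\mathbb{A}$ be a strict monoidal category with set of objects $\mathbb{A}_0$. The free cornering $\ulcorner\mathbb{A}\urcorner$ of $\mathbb{A}$ is the single object double category defined as follows. Its horizontal edge monoid (carrying top and bottom boundaries) is $(\mathbb{A}_0,\otimes,I)$, and its vertical edge monoid (carrying left and right boundaries) is the free monoid $(\mathbb{A}_0\times\{\circ,\bullet\})^*$, whose letters are written $A^\circ, A^\bullet$ and whose product and unit are again written $\otimes$ and $I$. Write $\ulcorner\mathbb{A}\urcorner[X;A;B;Y]$ for the set of cells with left, top, bottom and right boundary $X,A,B,Y$ respectively; horizontal composition of cells is written $\alpha\mid\beta$ and vertical composition ($\alpha$ above $\beta$) is written $\frac{\alpha}{\beta}$. The cells are freely generated under horizontal and vertical composition and identities (the vertical identity cell $1_A\in[I;A;A;I]$ of $A\in\mathbb{A}_0$ and the horizontal identity cell $1_X\in[X;I;I;X]$ of a word $X$) by a cell $\ulcorner f\urcorner\in[I;A;B;I]$ for every morphism $f:A\to B$ of $\mathbb{A}$ and by four corner cells, in $[I;A;I;A^\circ]$, $[A^\circ;I;A;I]$, $[I;I;A;A^\bullet]$ and $[A^\bullet;A;I;I]$,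 for every object $A$. They are subject to the axioms of a double category, to $\ulcorner 1_A\urcorner=1_A$, $\ulcorner fg\urcorner=\frac{\ulcorner f\urcorner}{\ulcorner g\urcorner}$ (with $fg$ the composite in diagrammatic order), $\ulcorner f\otimes g\urcorner=\ulcorner f\urcorner\mid\ulcorner g\urcorner$, and to the yanking equations: the horizontal composite of the first two corner cells is $1_A$, the vertical composite of the second above the first is $1_{A^\circ}$, the horizontal composite of the last two is $1_A$, and the vertical composite of the third above the fourth is $1_{A^\bullet}$. Let $n\geq 1$, let $A_1,B_1,\ldots,A_n,B_n$ be objects of $\mathbb{A}$, and let $X=A_1^\bullet\otimes B_1^\circ\otimes\cdots\otimes A_n^\bullet\otimes B_n^\circ$. For objects $M_1,\ldots,M_{n-1}$ of $\mathbb{A}$ put $M_0=M_n=I$. For morphisms $f_i:M_{i-1}\otimes A_i\to M_i\otimes B_i$ of $\mathbb{A}$ ($1\le i\le n$), let $\langle f_1\mid\cdots\mid f_n\rangle\in\ulcorner\mathbb{A}\urcorner[I;I;I;X]$ be the vertical composite, with $i=1$ on top, of the cells in $[I;M_{i-1};M_i;A_i^\bullet\otimes B_i^\circ]$ obtained by receiving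 $A_i$ from the right next to $1_{M_{i-1}}$ (corner cell in $[I;I;A_i;A_i^\bullet]$), applying $\ulcorner f_i\urcorner$, and sending $B_i$ to the right next to $1_{M_i}$ (corner cell in $[I;B_i;I;B_i^\circ]$). Then there is a bijection $$\int^{M_1,\ldots,M_{n-1}}\prod_{i=1}^n\mathbb{A}(M_{i-1}\otimes A_i,\,M_i\otimes B_i)\;\cong\;\ulcorner\mathbb{A}\urcorner[I;I;I;X]$$ sending the class of $(f_1,\ldots,f_n)$ to $\langle f_1\mid\cdots\mid f_n\rangle$. In particular, every cell in $\ulcorner\mathbb{A}\urcorner[I;I;I;X]$ is of the form $\langle f_1\mid\cdots\mid f_n\rangle$, and two such cells are equal if and only if their tuples are related by the equivalence relation generated by $$\bigl(f_1(m_1\otimes 1),\,f_2(m_2\otimes 1),\ldots,f_n\bigr)\sim\bigl(f_1,\,(m_1\otimes 1)f_2,\ldots,(m_{n-1}\otimes 1)f_n\bigr)$$ for morphisms $m_i:M_i\to N_i$ ($1\le i\le n-1$) and $f_i:N_{i-1}\otimes A_i\to M_i\otimes B_i$ ($1\le i\le n$), where $M_0=N_0=M_n=N_n=I$ and composition is in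 diagrammatic order. -/

import Mathlib

open CategoryTheory MonoidalCategory Limits Opposite

universe v u

/-- A monoidal category is *strict* if its associators and unitors are identities, that is, the
tensor product of objects is strictly associative and unital, and the structural isomorphisms are
the ones given by these equalities. -/
class StrictMonoidal (C : Type u) [Category.{v} C] [MonoidalCategory C] : Prop where
  tensor_assoc : ∀ a b c : C, (a ⊗ b) ⊗ c = a ⊗ (b ⊗ c)
  unit_tensor : ∀ a : C, 𝟙_ C ⊗ a = a
  tensor_unit : ∀ a : C, a ⊗ 𝟙_ C = a
  associator_eqToIso : ∀ a b c : C, α_ a b c = eqToIso (tensor_assoc a b c)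
  leftUnitor_eqToIso : ∀ a : C, λ_ a = eqToIso (unit_tensor a)
  rightUnitor_eqToIso : ∀ a : C, ρ_ a = eqToIso (tensor_unit a)

namespace FreeCornering

/-- The two polarities `∘` and `•`. -/
inductive Polarity
  | circ
  | bullet

/-- The vertical edge monoid of the free cornering: the free monoid on polarized objects. -/
abbrev VEdge (C : Type u) : Type u := FreeMonoid (C × Polarity)

/-- The one-letter word `a°`. -/
abbrev circ {C : Type u} (a : C) : VEdge C := FreeMonoid.of (a, Polarity.circ)

/-- The one-letter word `a•`. -/
abbrev bullet {C : Type u} (a : C) : VEdge C := FreeMonoid.of (a, Polarity.bullet)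

section

variable (C : Type u) [Category.{v} C] [MonoidalCategory C]

/-- Formal cells: the expressions built from the generating cells of the free cornering by
identities and by horizontal and vertical composition. `PreCell C x a b y` is the type of formal
cells with left boundary `x`, top boundary `a`, bottom boundary `b` and right boundary `y`. -/
inductive PreCell : VEdge C → C → C → VEdge C → Type (max u v)
  /-- the vertical cell of a morphism -/
  | gen {a b : C} (f : a ⟶ b) : PreCell 1 a b 1
  /-- corner: `a` comes in at the top and leaves to the right -/
  | sendRight (a : C) : PreCell 1 a (𝟙_ C) (circ a)
  /-- corner: `a` comes in from the left and leaves at the bottom -/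
  | recvLeft (a : C) : PreCell (circ a) (𝟙_ C) a 1
  /-- corner: `a` comes in from the right and leaves at the bottom -/
  | recvRight (a : C) : PreCell 1 (𝟙_ C) a (bullet a)
  /-- corner: `a` comes in at the top and leaves to the left -/
  | sendLeft (a : C) : PreCell (bullet a) a (𝟙_ C) 1
  /-- the identity cell of a horizontal edge `a`, drawn as a vertical wire -/
  | vid (a : C) : PreCell 1 a a 1
  /-- the identity cell of a vertical edge `x`, drawn as horizontal wires -/
  | hid (x : VEdge C) : PreCell x (𝟙_ C) (𝟙_ C) x
  /-- horizontal composition `α | β` -/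
  | hcomp {x y z : VEdge C} {a b c d : C} (α : PreCell x a b y) (β : PreCell y c d z) :
      PreCell x (a ⊗ c) (b ⊗ d) z
  /-- vertical composition, `α` above `β` -/
  | vcomp {x y z w : VEdge C} {a b c : C} (α : PreCell x a b y) (β : PreCell z b c w) :
      PreCell (x * z) a c (y * w)

end

section

variable {C : Type u} [Category.{v} C] [MonoidalCategory C]

/-- The congruence on formal cells generated by the axioms of a single object double category
together with the defining equations of the free cornering. The two sides of an axiom may have
boundaries that agree only by associativity or unitality of `⊗`, hence the separate indices;
over a strict monoidal category, related formal cells always have equal boundaries, see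
`CellEq.boundary_eq`. -/
inductive CellEq : ∀ {x : VEdge C} {a b : C} {y : VEdge C} {x' : VEdge C} {a' b' : C} {y' : VEdge C},
    PreCell C x a b y → PreCell C x' a' b' y' → Prop
  -- congruence
  | refl {x y : VEdge C} {a b : C} (α : PreCell C x a b y) : CellEq α α
  | symm {x y x' y' : VEdge C} {a b a' b' : C} {α : PreCell C x a b y}
      {α' : PreCell C x' a' b' y'} : CellEq α α' → CellEq α' α
  | trans {x y x' y' x'' y'' : VEdge C} {a b a' b' a'' b'' : C} {α : PreCell C x a b y}
      {α' : PreCell C x' a' b' y'} {α'' : PreCell C x'' a'' b'' y''} :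
      CellEq α α' → CellEq α' α'' → CellEq α α''
  | hcomp_congr {x y z x' y' z' : VEdge C} {a b c d a' b' c' d' : C}
      {α : PreCell C x a b y} {β : PreCell C y c d z}
      {α' : PreCell C x' a' b' y'} {β' : PreCell C y' c' d' z'} :
      CellEq α α' → CellEq β β' → CellEq (α.hcomp β) (α'.hcomp β')
  | vcomp_congr {x y z w x' y' z' w' : VEdge C} {a b c a' b' c' : C}
      {α : PreCell C x a b y} {β : PreCell C z b c w}
      {α' : PreCell C x' a' b' y'} {β' : PreCell C z' b' c' w'} :
      CellEq α α' → CellEq β β' → CellEq (α.vcomp β) (α'.vcomp β')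
  -- horizontal composition is associative and unital
  | hcomp_assoc {x y z w : VEdge C} {a b c d e g : C} (α : PreCell C x a b y)
      (β : PreCell C y c d z) (γ : PreCell C z e g w) :
      CellEq ((α.hcomp β).hcomp γ) (α.hcomp (β.hcomp γ))
  | hid_hcomp {x y : VEdge C} {a b : C} (α : PreCell C x a b y) :
      CellEq ((PreCell.hid x).hcomp α) α
  | hcomp_hid {x y : VEdge C} {a b : C} (α : PreCell C x a b y) :
      CellEq (α.hcomp (PreCell.hid y)) α
  -- vertical composition is associative and unital
  | vcomp_assoc {x y x' y' x'' y'' : VEdge C} {a b c d : C} (α : PreCell C x a b y)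
      (β : PreCell C x' b c y') (γ : PreCell C x'' c d y'') :
      CellEq ((α.vcomp β).vcomp γ) (α.vcomp (β.vcomp γ))
  | vid_vcomp {x y : VEdge C} {a b : C} (α : PreCell C x a b y) :
      CellEq ((PreCell.vid a).vcomp α) α
  | vcomp_vid {x y : VEdge C} {a b : C} (α : PreCell C x a b y) :
      CellEq (α.vcomp (PreCell.vid b)) α
  -- identity cells are compatible with composition of edges, and the two identities of the
  -- trivial edge coincide
  | vid_tensor (a b : C) :
      CellEq (PreCell.vid (a ⊗ b)) ((PreCell.vid a).hcomp (PreCell.vid b))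
  | hid_mul (x y : VEdge C) :
      CellEq (PreCell.hid (x * y)) ((PreCell.hid x).vcomp (PreCell.hid y))
  | hid_one : CellEq (PreCell.hid (1 : VEdge C)) (PreCell.vid (𝟙_ C))
  -- interchange
  | interchange {x y z x' y' z' : VEdge C} {a b c d e g : C}
      (α : PreCell C x a b y) (β : PreCell C x' b c y')
      (γ : PreCell C y d e z) (δ : PreCell C y' e g z') :
      CellEq ((α.vcomp β).hcomp (γ.vcomp δ)) ((α.hcomp γ).vcomp (β.hcomp δ))
  -- the vertical cells of morphisms are functorial and monoidal
  | gen_id (a : C) : CellEq (PreCell.gen (𝟙 a)) (PreCell.vid a)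
  | gen_comp {a b c : C} (f : a ⟶ b) (g : b ⟶ c) :
      CellEq (PreCell.gen (f ≫ g)) ((PreCell.gen f).vcomp (PreCell.gen g))
  | gen_tensor {a b c d : C} (f : a ⟶ b) (g : c ⟶ d) :
      CellEq (PreCell.gen (f ⊗ₘ g)) ((PreCell.gen f).hcomp (PreCell.gen g))
  -- the yanking equations
  | yank_circ_hcomp (a : C) :
      CellEq ((PreCell.sendRight a).hcomp (PreCell.recvLeft a)) (PreCell.vid a)
  | yank_circ_vcomp (a : C) :
      CellEq ((PreCell.recvLeft a).vcomp (PreCell.sendRight a)) (PreCell.hid (circ a))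
  | yank_bullet_hcomp (a : C) :
      CellEq ((PreCell.recvRight a).hcomp (PreCell.sendLeft a)) (PreCell.vid a)
  | yank_bullet_vcomp (a : C) :
      CellEq ((PreCell.recvRight a).vcomp (PreCell.sendLeft a)) (PreCell.hid (bullet a))

theorem CellEq.boundary_eq [StrictMonoidal C] {x y x' y' : VEdge C} {a b a' b' : C}
    {α : PreCell C x a b y} {α' : PreCell C x' a' b' y'} (h : CellEq α α') :
    x = x' ∧ a = a' ∧ b = b' ∧ y = y' := by
  induction h <;>
    simp_all [StrictMonoidal.tensor_assoc, StrictMonoidal.unit_tensor,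
      StrictMonoidal.tensor_unit, mul_assoc]

variable (C) in
/-- Formal cells with a given boundary, up to the equations of the free cornering. -/
instance cellSetoid (x : VEdge C) (a b : C) (y : VEdge C) : Setoid (PreCell C x a b y) where
  r α β := CellEq α β
  iseqv := ⟨CellEq.refl, CellEq.symm, CellEq.trans⟩

variable (C) in
/-- The cell-set of the free cornering of `C` with left boundary `x`, top boundary `a`,
bottom boundary `b` and right boundary `y`. -/
def Cell (x : VEdge C) (a b : C) (y : VEdge C) : Type (max u v) :=
  Quotient (cellSetoid C x a b y)

namespace Cell

/-- The class of a formal cell. -/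
def mk {x y : VEdge C} {a b : C} (α : PreCell C x a b y) : Cell C x a b y :=
  Quotient.mk _ α

/-- Horizontal composition of cells. -/
def hcomp {x y z : VEdge C} {a b c d : C} :
    Cell C x a b y → Cell C y c d z → Cell C x (a ⊗ c) (b ⊗ d) z :=
  Quotient.map₂ PreCell.hcomp fun _ _ h _ _ h' => CellEq.hcomp_congr h h'

/-- Vertical composition of cells. -/
def vcomp {x y z w : VEdge C} {a b c : C} :
    Cell C x a b y → Cell C z b c w → Cell C (x * z) a c (y * w) :=
  Quotient.map₂ PreCell.vcomp fun _ _ h _ _ h' => CellEq.vcomp_congr h h'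

/-- Transport of a cell along equalities of its boundaries. -/
def cast {x y x' y' : VEdge C} {a b a' b' : C} (hx : x = x') (ha : a = a') (hb : b = b')
    (hy : y = y') (α : Cell C x a b y) : Cell C x' a' b' y' :=
  hx ▸ ha ▸ hb ▸ hy ▸ α

end Cell

/-- The word `A₁• ⊗ B₁° ⊗ ⋯ ⊗ Aₙ• ⊗ Bₙ°` (with `Aᵢ` and `Bᵢ` numbered from `0` here). -/
def altWord : ∀ (n : ℕ), (Fin n → C) → (Fin n → C) → VEdge C
  | 0, _, _ => 1
  | n + 1, A, B =>
    (bullet (A 0) * circ (B 0)) * altWord n (fun i => A i.succ) (fun i => B i.succ)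

/-- One tooth of a comb: given a morphism `f : M ⊗ a ⟶ N ⊗ b`, start with `M`, receive `a` from
the right, apply `f`, send `b` to the right, end with `N`. -/
def tooth [StrictMonoidal C] {M N a b : C} (f : M ⊗ a ⟶ N ⊗ b) :
    Cell C 1 M N (bullet a * circ b) :=
  Cell.cast (by simp) (StrictMonoidal.tensor_unit M) (StrictMonoidal.tensor_unit N) (by simp)
    ((((Cell.mk (PreCell.vid M)).hcomp (Cell.mk (PreCell.recvRight a))).vcomp
        (Cell.mk (PreCell.gen f))).vcomp
      ((Cell.mk (PreCell.vid N)).hcomp (Cell.mk (PreCell.sendRight b))))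

/-- The vertical composite of the teeth given by `fᵢ : P i ⊗ Aᵢ ⟶ P (i + 1) ⊗ Bᵢ`, the first one
on top. -/
def teeth [StrictMonoidal C] : ∀ (n : ℕ) (A B : Fin n → C) (P : ℕ → C)
    (_ : ∀ i : Fin n, P (i : ℕ) ⊗ A i ⟶ P ((i : ℕ) + 1) ⊗ B i), Cell C 1 (P 0) (P n) (altWord n A B)
  | 0, _, _, P, _ => Cell.mk (PreCell.vid (P 0))
  | n + 1, A, B, P, f =>
    Cell.cast (one_mul 1) rfl rfl rfl
      ((tooth (f 0)).vcomp
        (teeth n (fun i => A i.succ) (fun i => B i.succ) (fun j => P (j + 1))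
          (fun i => f i.succ)))

/-- A finite sequence of objects, continued by the unit object. -/
def padObj : ∀ {k : ℕ}, (Fin k → C) → ℕ → C
  | 0, _, _ => 𝟙_ C
  | _ + 1, M, 0 => M 0
  | _ + 1, M, j + 1 => padObj (fun i => M i.succ) j

/-- A finite sequence of morphisms, continued by identities of the unit object. -/
def padMap : ∀ {k : ℕ} {M N : Fin k → C} (_ : ∀ i, M i ⟶ N i) (j : ℕ), padObj M j ⟶ padObj N j
  | 0, _, _, _, _ => 𝟙 (𝟙_ C)
  | _ + 1, _, _, h, 0 => h 0
  | _ + 1, _, _, h, j + 1 => padMap (fun i => h i.succ) j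

/-- The objects `M₀, M₁, …, M_{n-1}, Mₙ, …` where `M₁, …, M_{n-1}` are the given ones and all the
others, in particular `M₀` and `Mₙ`, are the unit object. -/
def memObj {k : ℕ} (M : Fin k → C) : ℕ → C
  | 0 => 𝟙_ C
  | j + 1 => padObj M j

/-- The action of `memObj` on morphisms: identities at all the unit objects put in. -/
def memMap {k : ℕ} {M N : Fin k → C} (h : ∀ i, M i ⟶ N i) : ∀ j : ℕ, memObj M j ⟶ memObj N j
  | 0 => 𝟙 (𝟙_ C)
  | j + 1 => padMap h j

theorem padObj_of_lt {k : ℕ} (M : Fin k → C) (i : Fin k) : padObj M i = M i := by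
  induction k with
  | zero => exact i.elim0
  | succ k ih =>
    cases i using Fin.cases with
    | zero => rfl
    | succ i => exact ih (fun i => M i.succ) i

theorem padObj_last {k : ℕ} (M : Fin k → C) : padObj M k = 𝟙_ C := by
  induction k with
  | zero => rfl
  | succ k ih => exact ih (fun i => M i.succ)

theorem memObj_last {k : ℕ} (M : Fin k → C) : memObj M (k + 1) = 𝟙_ C :=
  padObj_last M

theorem padMap_id {k : ℕ} (M : Fin k → C) (j : ℕ) :
    padMap (fun i => 𝟙 (M i)) j = 𝟙 (padObj M j) := by
  induction k generalizing j with
  | zero => rfl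
  | succ k ih =>
    cases j with
    | zero => rfl
    | succ j => exact ih (fun i => M i.succ) j

theorem padMap_comp {k : ℕ} {M N P : Fin k → C} (h : ∀ i, M i ⟶ N i) (h' : ∀ i, N i ⟶ P i)
    (j : ℕ) : padMap (fun i => h i ≫ h' i) j = padMap h j ≫ padMap h' j := by
  induction k generalizing j with
  | zero => exact (Category.comp_id (𝟙 (𝟙_ C))).symm
  | succ k ih =>
    cases j with
    | zero => rfl
    | succ j => exact ih (fun i => h i.succ) (fun i => h' i.succ) j

/-- The functor sending `(M₁, …, M_{n-1})` to the sequence `M₀, M₁, …, M_{n-1}, Mₙ, …`, where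
`M₀` and `Mₙ` are the unit object. -/
def mem (C : Type u) [Category.{v} C] [MonoidalCategory C] (k : ℕ) : (Fin k → C) ⥤ (ℕ → C) where
  obj M := memObj M
  map h := memMap h
  map_id M := by
    funext j
    cases j with
    | zero => rfl
    | succ j => exact padMap_id M j
  map_comp h h' := by
    funext j
    cases j with
    | zero => exact (Category.comp_id (𝟙 (𝟙_ C))).symm
    | succ j => exact padMap_comp h h' j

/-- The set `∏ᵢ C(M_{i-1} ⊗ Aᵢ, Nᵢ ⊗ Bᵢ)` over `i = 1, …, n` for `n = k + 1`, where
`M₀` and `Nₙ` are the unit object. -/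
abbrev Tuple {k : ℕ} (A B : Fin (k + 1) → C) (M N : Fin k → C) : Type v :=
  ∀ i : Fin (k + 1), ((mem C k).obj M (i : ℕ) ⊗ A i ⟶ (mem C k).obj N ((i : ℕ) + 1) ⊗ B i)

/-- The contravariant action on the domains. -/
def Tuple.precomp {k : ℕ} {A B : Fin (k + 1) → C} {M M' N : Fin k → C} (h : M ⟶ M')
    (f : Tuple A B M' N) : Tuple A B M N :=
  fun i => ((mem C k).map h (i : ℕ) ▷ A i) ≫ f i

/-- The covariant action on the codomains. -/
def Tuple.postcomp {k : ℕ} {A B : Fin (k + 1) → C} {M N N' : Fin k → C}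
    (f : Tuple A B M N) (h : N ⟶ N') : Tuple A B M N' :=
  fun i => f i ≫ ((mem C k).map h ((i : ℕ) + 1) ▷ B i)

/-- The functor `(M, N) ↦ ∏ᵢ C(M_{i-1} ⊗ Aᵢ, Nᵢ ⊗ Bᵢ)`, contravariant in `M` and covariant in `N`.
The values are lifted to a universe in which the coend over `C` can be formed. -/
def tupleFunctor {k : ℕ} (A B : Fin (k + 1) → C) :
    (Fin k → C)ᵒᵖ ⥤ (Fin k → C) ⥤ Type (max u v) where
  obj M :=
    { obj := fun N => ULift.{u} (Tuple A B M.unop N)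
      map := fun h => TypeCat.ofHom fun f => ULift.up (f.down.postcomp h)
      map_id := fun N => by
        ext f i
        simp [Tuple.postcomp]
      map_comp := fun h h' => by
        ext f i
        simp [Tuple.postcomp] }
  map h :=
    { app := fun N => TypeCat.ofHom fun f => ULift.up (f.down.precomp h.unop)
      naturality := fun N N' h' => by
        ext f i
        simp [Tuple.precomp, Tuple.postcomp] }
  map_id M := by
    ext N f i
    simp [Tuple.precomp]
  map_comp h h' := by
    ext N f i
    simp [Tuple.precomp]

/-- The cell `⟨f₁ ∣ ⋯ ∣ fₙ⟩` of the free cornering given by a tuple of morphisms. -/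
def comb [StrictMonoidal C] {k : ℕ} {A B : Fin (k + 1) → C} {M : Fin k → C}
    (f : Tuple A B M M) : Cell C 1 (𝟙_ C) (𝟙_ C) (altWord (k + 1) A B) :=
  Cell.cast rfl rfl (memObj_last M) rfl (teeth (k + 1) A B ((mem C k).obj M) f)

/-- The sliding relation on tuples of morphisms:
`⟨f₁ (m₁ ⊗ 1) ∣ f₂ (m₂ ⊗ 1) ∣ ⋯ ∣ fₙ⟩` is related to `⟨f₁ ∣ (m₁ ⊗ 1) f₂ ∣ ⋯ ∣ (m_{n-1} ⊗ 1) fₙ⟩`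
(composition in diagrammatic order) for all `mᵢ : Mᵢ ⟶ Nᵢ` and
`fᵢ : N_{i-1} ⊗ Aᵢ ⟶ Mᵢ ⊗ Bᵢ`. -/
inductive Slide {k : ℕ} (A B : Fin (k + 1) → C) :
    (Σ M : Fin k → C, Tuple A B M M) → (Σ M : Fin k → C, Tuple A B M M) → Prop
  | slide {M N : Fin k → C} (m : M ⟶ N) (f : Tuple A B N M) :
      Slide A B ⟨N, f.postcomp m⟩ ⟨M, f.precomp m⟩

end

end FreeCornering

/-! Sliding does not change a comb: a morphism on the memory wire passes the corner cells next to it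
(`gen_vcomp_inCell`, `outCell_vcomp_gen`), so it moves from the bottom of one tooth to the top of
the next (`gen_vcomp_teethPre`, `comb_postcomp`).

Every cell is a comb. Call a cell normal if it is a vertical composite of steps, one for each letter
of its right boundary, followed by the cell of a morphism; a step receives or sends one object on
the right. Normal cells are stable under horizontal composition on the right with an arbitrary cell
(`IsNormal.hcomp`): a corner opening to the right turns a morphism into a step, and a corner opening
to the left cancels a step by yanking. Starting from the identity of the unit, every cell with
trivial left boundary is therefore normal, and over an alternating word consecutive steps merge into
teeth (`exists_comb_eq`).

Equal combs come from related tuples. This needs an invariant, provided by a model of the free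
cornering in profunctors: `a°` becomes `(c, d) ↦ (c ⟶ d ⊗ a)`, `a•` becomes `(c, d) ↦ (c ⊗ a ⟶ d)`,
a word becomes the coend composite of its letters, and a cell becomes a natural family of maps `P c
d → Q (c ⊗ a) (d ⊗ b)`. All equations hold in the model (`CellEq.interp_same`). Evaluating a comb at
the identity of the unit gives the class of its tuple in the profunctor of the alternating word. By
co-Yoneda the composite of `a•` and `b°` is `(c, d) ↦ (c ⊗ a ⟶ d ⊗ b)`, so the only identifications
left in that profunctor are slides along the memory objects (`FromTuple.exists_elt_to_classes`). -/

namespace FreeCornering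

/-! ### Combs are invariant under sliding -/

section

variable {C : Type u} [Category.{v} C] [MonoidalCategory C]

local infix:50 " ≈ᶜ " => CellEq

instance {x y x' y' x'' y'' : VEdge C} {a b a' b' a'' b'' : C} :
    Trans (CellEq (C := C) (x := x) (a := a) (b := b) (y := y) (x' := x') (a' := a') (b' := b')
      (y' := y')) (CellEq (x' := x'') (a' := a'') (b' := b'') (y' := y''))
      CellEq := ⟨CellEq.trans⟩

/-- Transport of a formal cell along equalities of its boundaries. -/
def PreCell.cast {x y x' y' : VEdge C} {a b a' b' : C} (hx : x = x') (ha : a = a') (hb : b = b')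
    (hy : y = y') (α : PreCell C x a b y) : PreCell C x' a' b' y' :=
  hx ▸ ha ▸ hb ▸ hy ▸ α

/-- `CellEq` may relate cells whose boundary indices differ, so casts disappear from calculations
with formal cells. This is the reason for working with `PreCell` and passing to `Cell` only at the
end. -/
theorem PreCell.cast_cellEq {x y x' y' : VEdge C} {a b a' b' : C} (hx : x = x') (ha : a = a')
    (hb : b = b') (hy : y = y') (α : PreCell C x a b y) : α.cast hx ha hb hy ≈ᶜ α := by
  subst hx ha hb hy
  exact .refl _

theorem Cell.mk_cast {x y x' y' : VEdge C} {a b a' b' : C} (hx : x = x') (ha : a = a')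
    (hb : b = b') (hy : y = y') (α : PreCell C x a b y) :
    Cell.mk (α.cast hx ha hb hy) = Cell.cast hx ha hb hy (Cell.mk α) := by
  subst hx ha hb hy
  rfl

theorem Cell.mk_eq_mk {x y : VEdge C} {a b : C} {α β : PreCell C x a b y} :
    Cell.mk α = Cell.mk β ↔ α ≈ᶜ β :=
  Quotient.eq

namespace CellEq

theorem hcomp_vid_unit {x : VEdge C} {a b : C} (α : PreCell C x a b 1) :
    α.hcomp (.vid (𝟙_ C)) ≈ᶜ α :=
  (hcomp_congr (.refl α) hid_one.symm).trans (.hcomp_hid α)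

theorem vid_unit_hcomp {x : VEdge C} {a b : C} (α : PreCell C 1 a b x) :
    (PreCell.vid (𝟙_ C)).hcomp α ≈ᶜ α :=
  (hcomp_congr hid_one.symm (.refl α)).trans (.hid_hcomp α)

theorem gen_whiskerRight {a b : C} (f : a ⟶ b) (c : C) :
    PreCell.gen (f ▷ c) ≈ᶜ (PreCell.gen f).hcomp (.vid c) := by
  rw [← tensorHom_id]
  exact (gen_tensor f (𝟙 c)).trans (hcomp_congr (.refl _) (gen_id c))

theorem gen_eqToHom {a b : C} (h : a = b) : PreCell.gen (eqToHom h) ≈ᶜ PreCell.vid a := by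
  subst h
  exact gen_id a

theorem hcomp_eq_left_right {x y : VEdge C} {a b c d : C} (α : PreCell C x a b 1)
    (β : PreCell C 1 c d y) : α.hcomp β ≈ᶜ (α.hcomp (.vid c)).vcomp ((PreCell.vid b).hcomp β) :=
  (hcomp_congr (vcomp_vid α).symm (vid_vcomp β).symm).trans (interchange _ _ _ _)

theorem hcomp_eq_right_left {x y : VEdge C} {a b c d : C} (α : PreCell C x a b 1)
    (β : PreCell C 1 c d y) : α.hcomp β ≈ᶜ ((PreCell.vid a).hcomp β).vcomp (α.hcomp (.vid d)) :=
  (hcomp_congr (vid_vcomp α).symm (vcomp_vid β).symm).trans (interchange _ _ _ _)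

end CellEq

/-- Beyond the given morphisms there are only identities of the unit, but `padObj M k` is the unit
only up to a propositional equality. -/
theorem padMap_last {k : ℕ} {M N : Fin k → C} (h : ∀ i, M i ⟶ N i) :
    padMap h k = eqToHom ((padObj_last M).trans (padObj_last N).symm) := by
  induction k with
  | zero => rfl
  | succ k ih => exact ih (fun i => h i.succ)

variable [StrictMonoidal C]

/-- Receive `a` from the right, next to a wire `c`. -/
def inCell (c a : C) : PreCell C 1 c (c ⊗ a) (bullet a) :=
  ((PreCell.vid c).hcomp (.recvRight a)).cast rfl (StrictMonoidal.tensor_unit c) rfl rfl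

/-- Send `a` to the right, next to a wire `c`. -/
def outCell (c a : C) : PreCell C 1 (c ⊗ a) c (circ a) :=
  ((PreCell.vid c).hcomp (.sendRight a)).cast rfl rfl (StrictMonoidal.tensor_unit c) rfl

theorem inCell_cellEq (c a : C) : inCell c a ≈ᶜ (PreCell.vid c).hcomp (.recvRight a) :=
  PreCell.cast_cellEq _ _ _ _ _

theorem outCell_cellEq (c a : C) : outCell c a ≈ᶜ (PreCell.vid c).hcomp (.sendRight a) :=
  PreCell.cast_cellEq _ _ _ _ _

theorem gen_hcomp_recvRight {c d : C} (g : c ⟶ d) (a : C) :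
    (PreCell.gen g).hcomp (.recvRight a) ≈ᶜ (inCell c a).vcomp (.gen (g ▷ a)) :=
  (CellEq.hcomp_eq_right_left _ _).trans
    (.vcomp_congr (inCell_cellEq c a).symm (CellEq.gen_whiskerRight g a).symm)

theorem gen_hcomp_sendRight {c d : C} (g : c ⟶ d) (a : C) :
    (PreCell.gen g).hcomp (.sendRight a) ≈ᶜ (PreCell.gen (g ▷ a)).vcomp (outCell d a) :=
  (CellEq.hcomp_eq_left_right _ _).trans
    (.vcomp_congr (CellEq.gen_whiskerRight g a).symm (outCell_cellEq d a).symm)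

/-- Both sides are `g` placed beside the corner, performed in the two possible orders; likewise for
`outCell_vcomp_gen`. -/
theorem gen_vcomp_inCell {c d : C} (g : c ⟶ d) (a : C) :
    (PreCell.gen g).vcomp (inCell d a) ≈ᶜ (inCell c a).vcomp (.gen (g ▷ a)) :=
  calc (PreCell.gen g).vcomp (inCell d a)
    _ ≈ᶜ ((PreCell.gen g).hcomp (.vid (𝟙_ C))).vcomp ((PreCell.vid d).hcomp (.recvRight a)) :=
      .vcomp_congr (CellEq.hcomp_vid_unit _).symm (inCell_cellEq d a)
    _ ≈ᶜ (PreCell.gen g).hcomp (.recvRight a) := (CellEq.hcomp_eq_left_right _ _).symm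
    _ ≈ᶜ _ := gen_hcomp_recvRight g a

theorem outCell_vcomp_gen {c d : C} (g : c ⟶ d) (a : C) :
    (outCell c a).vcomp (.gen g) ≈ᶜ (PreCell.gen (g ▷ a)).vcomp (outCell d a) :=
  calc (outCell c a).vcomp (.gen g)
    _ ≈ᶜ ((PreCell.vid c).hcomp (.sendRight a)).vcomp ((PreCell.gen g).hcomp (.vid (𝟙_ C))) :=
      .vcomp_congr (outCell_cellEq c a) (CellEq.hcomp_vid_unit _).symm
    _ ≈ᶜ (PreCell.gen g).hcomp (.sendRight a) := (CellEq.hcomp_eq_right_left _ _).symm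
    _ ≈ᶜ _ := gen_hcomp_sendRight g a

theorem inCell_hcomp_sendLeft (c a : C) :
    (inCell c a).hcomp (.sendLeft a) ≈ᶜ PreCell.vid (c ⊗ a) :=
  calc (inCell c a).hcomp (.sendLeft a)
    _ ≈ᶜ ((PreCell.vid c).hcomp (.recvRight a)).hcomp (.sendLeft a) :=
      .hcomp_congr (inCell_cellEq c a) (.refl _)
    _ ≈ᶜ (PreCell.vid c).hcomp ((PreCell.recvRight a).hcomp (.sendLeft a)) :=
      .hcomp_assoc _ _ _
    _ ≈ᶜ (PreCell.vid c).hcomp (.vid a) := .hcomp_congr (.refl _) (.yank_bullet_hcomp a)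
    _ ≈ᶜ _ := (CellEq.vid_tensor c a).symm

theorem outCell_hcomp_recvLeft (c a : C) :
    (outCell c a).hcomp (.recvLeft a) ≈ᶜ PreCell.vid (c ⊗ a) :=
  calc (outCell c a).hcomp (.recvLeft a)
    _ ≈ᶜ ((PreCell.vid c).hcomp (.sendRight a)).hcomp (.recvLeft a) :=
      .hcomp_congr (outCell_cellEq c a) (.refl _)
    _ ≈ᶜ (PreCell.vid c).hcomp ((PreCell.sendRight a).hcomp (.recvLeft a)) :=
      .hcomp_assoc _ _ _
    _ ≈ᶜ (PreCell.vid c).hcomp (.vid a) := .hcomp_congr (.refl _) (.yank_circ_hcomp a)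
    _ ≈ᶜ _ := (CellEq.vid_tensor c a).symm

/-- The formal cell underlying a tooth. -/
def toothPre {M N a b : C} (f : M ⊗ a ⟶ N ⊗ b) : PreCell C 1 M N (bullet a * circ b) :=
  ((((PreCell.vid M).hcomp (.recvRight a)).vcomp (.gen f)).vcomp
    ((PreCell.vid N).hcomp (.sendRight b))).cast
      (by simp) (StrictMonoidal.tensor_unit M) (StrictMonoidal.tensor_unit N) (by simp)

/-- The formal cell underlying a vertical composite of teeth. -/
def teethPre : ∀ (n : ℕ) (A B : Fin n → C) (P : ℕ → C)
    (_ : ∀ i : Fin n, P (i : ℕ) ⊗ A i ⟶ P ((i : ℕ) + 1) ⊗ B i),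
    PreCell C 1 (P 0) (P n) (altWord n A B)
  | 0, _, _, P, _ => .vid (P 0)
  | n + 1, A, B, P, f =>
    ((toothPre (f 0)).vcomp
      (teethPre n (fun i => A i.succ) (fun i => B i.succ) (fun j => P (j + 1))
        (fun i => f i.succ))).cast (one_mul 1) rfl rfl rfl

/-- The formal cell underlying a comb. -/
def combPre {k : ℕ} {A B : Fin (k + 1) → C} {M : Fin k → C} (f : Tuple A B M M) :
    PreCell C 1 (𝟙_ C) (𝟙_ C) (altWord (k + 1) A B) :=
  (teethPre (k + 1) A B ((mem C k).obj M) f).cast rfl rfl (memObj_last M) rfl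

theorem mk_toothPre {M N a b : C} (f : M ⊗ a ⟶ N ⊗ b) : Cell.mk (toothPre f) = tooth f :=
  Cell.mk_cast _ _ _ _ _

theorem mk_teethPre : ∀ (n : ℕ) (A B : Fin n → C) (P : ℕ → C)
    (f : ∀ i : Fin n, P (i : ℕ) ⊗ A i ⟶ P ((i : ℕ) + 1) ⊗ B i),
    Cell.mk (teethPre n A B P f) = teeth n A B P f
  | 0, _, _, _, _ => rfl
  | n + 1, A, B, P, f => by
    rw [teeth, ← mk_teethPre, ← mk_toothPre]
    exact Cell.mk_cast _ _ _ _ _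

theorem mk_combPre {k : ℕ} {A B : Fin (k + 1) → C} {M : Fin k → C} (f : Tuple A B M M) :
    Cell.mk (combPre f) = comb f := by
  rw [comb, ← mk_teethPre]
  exact Cell.mk_cast _ _ _ _ _

theorem comb_eq_comb_iff {k : ℕ} {A B : Fin (k + 1) → C} {M N : Fin k → C} (f : Tuple A B M M)
    (g : Tuple A B N N) : comb f = comb g ↔ combPre f ≈ᶜ combPre g := by
  rw [← mk_combPre, ← mk_combPre, Cell.mk_eq_mk]

theorem toothPre_cellEq {M N a b : C} (f : M ⊗ a ⟶ N ⊗ b) :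
    toothPre f ≈ᶜ ((inCell M a).vcomp (.gen f)).vcomp (outCell N b) :=
  (PreCell.cast_cellEq _ _ _ _ _).trans
    (.vcomp_congr (.vcomp_congr (inCell_cellEq M a).symm (.refl _)) (outCell_cellEq N b).symm)

theorem teethPre_succ_cellEq (n : ℕ) (A B : Fin (n + 1) → C) (P : ℕ → C)
    (f : ∀ i : Fin (n + 1), P (i : ℕ) ⊗ A i ⟶ P ((i : ℕ) + 1) ⊗ B i) :
    teethPre (n + 1) A B P f ≈ᶜ (toothPre (f 0)).vcomp
      (teethPre n (fun i => A i.succ) (fun i => B i.succ) (fun j => P (j + 1))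
        (fun i => f i.succ)) :=
  PreCell.cast_cellEq _ _ _ _ _

theorem toothPre_whiskerRight_comp {M M' N a b : C} (m : M ⟶ M') (f : M' ⊗ a ⟶ N ⊗ b) :
    toothPre (m ▷ a ≫ f) ≈ᶜ (PreCell.gen m).vcomp (toothPre f) :=
  calc toothPre (m ▷ a ≫ f)
    _ ≈ᶜ ((inCell M a).vcomp (.gen (m ▷ a ≫ f))).vcomp (outCell N b) := toothPre_cellEq _
    _ ≈ᶜ ((inCell M a).vcomp ((PreCell.gen (m ▷ a)).vcomp (.gen f))).vcomp (outCell N b) :=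
      .vcomp_congr (.vcomp_congr (.refl _) (.gen_comp _ _)) (.refl _)
    _ ≈ᶜ (((inCell M a).vcomp (.gen (m ▷ a))).vcomp (.gen f)).vcomp (outCell N b) :=
      .vcomp_congr (.symm (.vcomp_assoc _ _ _)) (.refl _)
    _ ≈ᶜ (((PreCell.gen m).vcomp (inCell M' a)).vcomp (.gen f)).vcomp (outCell N b) :=
      .vcomp_congr (.vcomp_congr (gen_vcomp_inCell m a).symm (.refl _)) (.refl _)
    _ ≈ᶜ ((PreCell.gen m).vcomp ((inCell M' a).vcomp (.gen f))).vcomp (outCell N b) :=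
      .vcomp_congr (.vcomp_assoc _ _ _) (.refl _)
    _ ≈ᶜ (PreCell.gen m).vcomp (((inCell M' a).vcomp (.gen f)).vcomp (outCell N b)) :=
      .vcomp_assoc _ _ _
    _ ≈ᶜ _ := .vcomp_congr (.refl _) (toothPre_cellEq f).symm

theorem toothPre_comp_whiskerRight {M N N' a b : C} (f : M ⊗ a ⟶ N ⊗ b) (m : N ⟶ N') :
    toothPre (f ≫ m ▷ b) ≈ᶜ (toothPre f).vcomp (.gen m) :=
  calc toothPre (f ≫ m ▷ b)
    _ ≈ᶜ ((inCell M a).vcomp (.gen (f ≫ m ▷ b))).vcomp (outCell N' b) := toothPre_cellEq _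
    _ ≈ᶜ ((inCell M a).vcomp ((PreCell.gen f).vcomp (.gen (m ▷ b)))).vcomp (outCell N' b) :=
      .vcomp_congr (.vcomp_congr (.refl _) (.gen_comp _ _)) (.refl _)
    _ ≈ᶜ (((inCell M a).vcomp (.gen f)).vcomp (.gen (m ▷ b))).vcomp (outCell N' b) :=
      .vcomp_congr (.symm (.vcomp_assoc _ _ _)) (.refl _)
    _ ≈ᶜ ((inCell M a).vcomp (.gen f)).vcomp ((PreCell.gen (m ▷ b)).vcomp (outCell N' b)) :=
      .vcomp_assoc _ _ _
    _ ≈ᶜ ((inCell M a).vcomp (.gen f)).vcomp ((outCell N b).vcomp (.gen m)) :=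
      .vcomp_congr (.refl _) (outCell_vcomp_gen m b).symm
    _ ≈ᶜ (((inCell M a).vcomp (.gen f)).vcomp (outCell N b)).vcomp (.gen m) :=
      .symm (.vcomp_assoc _ _ _)
    _ ≈ᶜ _ := .vcomp_congr (toothPre_cellEq f).symm (.refl _)

/-- In the inductive step the first tooth absorbs `m 0` from above and releases `m 1` below, where
the induction hypothesis picks it up. Keeping arbitrary `m 0` and `m n` at the two ends is what
makes the induction work; for combs both are trivial. -/
theorem gen_vcomp_teethPre : ∀ (n : ℕ) (A B : Fin n → C) (P Q : ℕ → C) (m : ∀ j, P j ⟶ Q j)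
    (f : ∀ i : Fin n, Q (i : ℕ) ⊗ A i ⟶ P ((i : ℕ) + 1) ⊗ B i),
    (PreCell.gen (m 0)).vcomp (teethPre n A B Q fun i => f i ≫ m (i + 1) ▷ B i) ≈ᶜ
      (teethPre n A B P fun i => m i ▷ A i ≫ f i).vcomp (.gen (m n))
  | 0, _, _, _, _, m, _ => (CellEq.vcomp_vid _).trans (CellEq.vid_vcomp _).symm
  | n + 1, A, B, P, Q, m, f => by
    have ih := gen_vcomp_teethPre n (fun i => A i.succ) (fun i => B i.succ) (fun j => P (j + 1))
      (fun j => Q (j + 1)) (fun j => m (j + 1)) (fun i => f i.succ)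
    refine (CellEq.vcomp_congr (.refl _) (teethPre_succ_cellEq _ _ _ _ _)).trans ?_
    refine .trans ?_ (CellEq.vcomp_congr (teethPre_succ_cellEq _ _ _ _ _).symm (.refl _))
    refine .trans ?_ (CellEq.vcomp_congr (.vcomp_congr
      (toothPre_whiskerRight_comp (m 0) (f 0)).symm (.refl _)) (.refl _))
    refine (CellEq.vcomp_congr (.refl _) (.vcomp_congr
      (toothPre_comp_whiskerRight (f 0) (m 1)) (.refl _))).trans ?_
    refine (CellEq.vcomp_congr (.refl _) (.vcomp_assoc _ _ _)).trans ?_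
    refine (CellEq.vcomp_congr (.refl _) (.vcomp_congr (.refl _) ih)).trans ?_
    refine (CellEq.vcomp_assoc _ _ _).symm.trans ?_
    exact (CellEq.vcomp_assoc _ _ _).symm

theorem comb_postcomp {k : ℕ} {A B : Fin (k + 1) → C} {M N : Fin k → C} (m : M ⟶ N)
    (f : Tuple A B N M) : comb (f.postcomp m) = comb (f.precomp m) := by
  rw [comb_eq_comb_iff]
  have h := gen_vcomp_teethPre (k + 1) A B ((mem C k).obj M) ((mem C k).obj N)
    ((mem C k).map m) f
  have hl : PreCell.gen ((mem C k).map m (k + 1)) ≈ᶜ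
      PreCell.vid ((mem C k).obj M (k + 1)) := by
    have : (mem C k).map m (k + 1) = _ := padMap_last m
    rw [this]
    exact CellEq.gen_eqToHom _
  calc combPre (f.postcomp m)
    _ ≈ᶜ teethPre (k + 1) A B ((mem C k).obj N) (f.postcomp m) := PreCell.cast_cellEq _ _ _ _ _
    _ ≈ᶜ (PreCell.vid (𝟙_ C)).vcomp (teethPre (k + 1) A B ((mem C k).obj N) (f.postcomp m)) :=
      .symm (.vid_vcomp (a := 𝟙_ C) _)
    _ ≈ᶜ (PreCell.gen (𝟙 (𝟙_ C))).vcomp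
        (teethPre (k + 1) A B ((mem C k).obj N) (f.postcomp m)) :=
      .vcomp_congr (b := 𝟙_ C) (b' := 𝟙_ C) (CellEq.gen_id _).symm (.refl _)
    _ ≈ᶜ _ := h
    _ ≈ᶜ _ := .vcomp_congr (.refl _) hl
    _ ≈ᶜ teethPre (k + 1) A B ((mem C k).obj M) (f.precomp m) := .vcomp_vid _
    _ ≈ᶜ _ := (PreCell.cast_cellEq _ _ _ _ _).symm

theorem comb_eq_of_eqvGen {k : ℕ} {A B : Fin (k + 1) → C}
    {s t : Σ M : Fin k → C, Tuple A B M M} (h : Relation.EqvGen (Slide A B) s t) :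
    comb s.2 = comb t.2 := by
  induction h with
  | rel _ _ h =>
    cases h with
    | slide m f => exact comb_postcomp m f
  | refl => rfl
  | symm _ _ _ ih => exact ih.symm
  | trans _ _ _ _ _ ih ih' => exact ih.trans ih'

end

/-! ### Normal form of cells with trivial left boundary -/

section

variable {C : Type u} [Category.{v} C] [MonoidalCategory C]

local infix:50 " ≈ᶜ " => CellEq

/-- The profunctor of a polarized object: `a°` gives `(c, d) ↦ (c ⟶ d ⊗ a)` and
`a•` gives `(c, d) ↦ (c ⊗ a ⟶ d)`. -/
def Step : C × Polarity → C → C → Type v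
  | (a, .circ), c, d => c ⟶ d ⊗ a
  | (a, .bullet), c, d => c ⊗ a ⟶ d

namespace Step

/-- The contravariant action. -/
def pre : ∀ (l : C × Polarity) {c c' d : C}, (c' ⟶ c) → Step l c d → Step l c' d
  | (_, .circ), _, _, _, m, s => m ≫ s
  | (a, .bullet), _, _, _, m, s => m ▷ a ≫ s

/-- The covariant action. -/
def post : ∀ (l : C × Polarity) {c d d' : C}, Step l c d → (d ⟶ d') → Step l c d'
  | (a, .circ), _, _, _, s, m => s ≫ m ▷ a
  | (_, .bullet), _, _, _, s, m => s ≫ m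

end Step

variable [StrictMonoidal C]

/-- The formal cell of a step. -/
def stepPre : ∀ (l : C × Polarity) {c d : C}, Step l c d → PreCell C 1 c d (FreeMonoid.of l)
  | (a, .circ), _, d, s => (PreCell.gen s).vcomp (outCell d a)
  | (a, .bullet), c, _, s => (inCell c a).vcomp (.gen s)

theorem gen_vcomp_stepPre (l : C × Polarity) {c c' d : C} (m : c' ⟶ c) (s : Step l c d) :
    (PreCell.gen m).vcomp (stepPre l s) ≈ᶜ stepPre l (s.pre l m) := by
  rcases l with ⟨a, _ | _⟩
  · exact (CellEq.vcomp_assoc _ _ _).symm.trans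
      (.vcomp_congr (CellEq.gen_comp _ _).symm (.refl _))
  · exact (CellEq.vcomp_assoc _ _ _).symm.trans
      ((CellEq.vcomp_congr (gen_vcomp_inCell m a) (.refl _)).trans
        ((CellEq.vcomp_assoc _ _ _).trans (.vcomp_congr (.refl _) (CellEq.gen_comp _ _).symm)))

/-- The formal cells equal to a composite of steps, one for each letter of the word, followed by
the cell of a morphism. -/
def IsNormal : List (C × Polarity) → ∀ {x : VEdge C} {c d : C} {y : VEdge C},
    PreCell C x c d y → Prop
  | [], _, _, _, _, β => ∃ (c d : C) (g : c ⟶ d), β ≈ᶜ .gen g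
  | l :: w, _, _, _, _, β => ∃ (c m d : C) (s : Step l c m) (β' : PreCell C 1 m d w),
      IsNormal w β' ∧ β ≈ᶜ (stepPre l s).vcomp β'

namespace IsNormal

/-- `IsNormal` quantifies over the boundary objects of its witnesses, so it is transported along
`CellEq` without casts. The true boundaries are recovered from `CellEq.boundary_eq` in `exists_gen`
and `exists_step`. -/
theorem congr {w : List (C × Polarity)} {x y x' y' : VEdge C} {c d c' d' : C}
    {β : PreCell C x c d y} {β' : PreCell C x' c' d' y'} (h : IsNormal w β) (e : β ≈ᶜ β') :
    IsNormal w β' := by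
  cases w with
  | nil =>
    obtain ⟨_, _, g, h⟩ := h
    exact ⟨_, _, g, e.symm.trans h⟩
  | cons l w =>
    obtain ⟨_, _, _, s, β'', hβ, h⟩ := h
    exact ⟨_, _, _, s, β'', hβ, e.symm.trans h⟩

theorem gen {c d : C} (g : c ⟶ d) : IsNormal [] (PreCell.gen g) := ⟨_, _, g, .refl _⟩

theorem step {l : C × Polarity} {c d : C} (s : Step l c d) : IsNormal [l] (stepPre l s) :=
  ⟨_, _, _, s, .gen (𝟙 d), gen _, ((CellEq.vcomp_congr (.refl _) (.gen_id _)).trans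
    (.vcomp_vid _)).symm⟩

theorem exists_gen {x y : VEdge C} {c d : C} {β : PreCell C x c d y} (h : IsNormal [] β) :
    ∃ g : c ⟶ d, β ≈ᶜ .gen g := by
  obtain ⟨_, _, g, h⟩ := h
  obtain ⟨-, rfl, rfl, -⟩ := h.boundary_eq
  exact ⟨g, h⟩

theorem exists_step {l : C × Polarity} {w : List (C × Polarity)} {x y : VEdge C} {c d : C}
    {β : PreCell C x c d y} (h : IsNormal (l :: w) β) :
    ∃ (m : C) (s : Step l c m) (β' : PreCell C 1 m d w),
      IsNormal w β' ∧ β ≈ᶜ (stepPre l s).vcomp β' := by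
  obtain ⟨_, m, _, s, β', hβ, h⟩ := h
  obtain ⟨-, rfl, rfl, -⟩ := h.boundary_eq
  exact ⟨m, s, β', hβ, h⟩

theorem gen_vcomp {w : List (C × Polarity)} {y : VEdge C} {c d e : C} (g : c ⟶ d)
    {β : PreCell C 1 d e y} (h : IsNormal w β) : IsNormal w ((PreCell.gen g).vcomp β) := by
  cases w with
  | nil =>
    obtain ⟨g', h⟩ := h.exists_gen
    exact ⟨_, _, g ≫ g', (CellEq.vcomp_congr (.refl _) h).trans (CellEq.gen_comp g g').symm⟩
  | cons l w =>
    obtain ⟨m, s, β', hβ, h⟩ := h.exists_step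
    exact ⟨_, _, _, s.pre l g, β', hβ, (CellEq.vcomp_congr (.refl _) h).trans
      ((CellEq.vcomp_assoc _ _ _).symm.trans (.vcomp_congr (gen_vcomp_stepPre l g s) (.refl _)))⟩

theorem vcomp {w w' : VEdge C} {c d e : C} {β : PreCell C 1 c d w} {β' : PreCell C 1 d e w'}
    (h : IsNormal w β) (h' : IsNormal w' β') :
    IsNormal (w * w') (β.vcomp β') := by
  induction w generalizing c with
  | nil =>
    obtain ⟨g, h⟩ := h.exists_gen
    exact (h'.gen_vcomp g).congr (.vcomp_congr h.symm (.refl _))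
  | cons l w ih =>
    obtain ⟨m, s, β'', hβ, h⟩ := h.exists_step
    exact ⟨_, _, _, s, β''.vcomp β', ih hβ, (CellEq.vcomp_congr h (.refl _)).trans
      (CellEq.vcomp_assoc _ _ _)⟩

/-- Cutting a normal cell where its word is cut provides the two rows needed to apply interchange
against a vertical composite. -/
theorem exists_vcomp {w w' : VEdge C} {c d : C} {β : PreCell C 1 c d (w * w')}
    (h : IsNormal (w * w') β) :
    ∃ (m : C) (β₁ : PreCell C 1 c m w) (β₂ : PreCell C 1 m d w'),
      IsNormal w β₁ ∧ IsNormal w' β₂ ∧ β ≈ᶜ β₁.vcomp β₂ := by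
  induction w generalizing c with
  | nil =>
    exact ⟨c, .vid c, β, (gen (𝟙 c)).congr (.gen_id c), h, (CellEq.vid_vcomp β).symm⟩
  | cons l w ih =>
    obtain ⟨m, s, β', hβ, h⟩ := exists_step (w := FreeMonoid.ofList w * w') h
    obtain ⟨m', β₁, β₂, h₁, h₂, e⟩ := ih hβ
    exact ⟨m', (stepPre l s).vcomp β₁, β₂, ⟨_, _, _, s, β₁, h₁, .refl _⟩, h₂,
      h.trans ((CellEq.vcomp_congr (.refl _) e).trans (CellEq.vcomp_assoc _ _ _).symm)⟩

theorem exists_stepPre_vcomp_gen {l : C × Polarity} {x y : VEdge C} {c d : C}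
    {β : PreCell C x c d y} (h : IsNormal [l] β) :
    ∃ (m : C) (s : Step l c m) (g : m ⟶ d), β ≈ᶜ (stepPre l s).vcomp (.gen g) := by
  obtain ⟨m, s, β', hβ, h⟩ := h.exists_step
  obtain ⟨g, hg⟩ := hβ.exists_gen
  exact ⟨m, s, g, h.trans (.vcomp_congr (.refl _) hg)⟩

/-- Induction on `α` for all `β` at once. The left boundary of `α` has to be arbitrary, since the
two factors of a horizontal composite may meet along a nontrivial edge. -/
theorem hcomp {x y : VEdge C} {a b c d : C} {β : PreCell C 1 c d x} (h : IsNormal x β)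
    (α : PreCell C x a b y) : IsNormal y (β.hcomp α) := by
  induction α generalizing c d with
  | gen f =>
    obtain ⟨g, h⟩ := h.exists_gen
    exact (gen (g ⊗ₘ f)).congr ((CellEq.gen_tensor g f).trans (.hcomp_congr h.symm (.refl _)))
  | sendRight a =>
    obtain ⟨g, h⟩ := h.exists_gen
    exact (step (l := (a, .circ)) (c := c ⊗ a) (d := d) (g ▷ a)).congr
      ((gen_hcomp_sendRight g a).symm.trans (.hcomp_congr h.symm (.refl _)))
  | recvLeft a =>
    obtain ⟨m, s, g, h⟩ := h.exists_stepPre_vcomp_gen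
    change c ⟶ m ⊗ a at s
    refine (gen (s ≫ g ▷ a)).congr ((CellEq.gen_comp _ _).trans (.symm ?_))
    -- The corner is padded with identities to three rows, matching the rows `s`, `outCell` and `g`
    -- of `β`. After two interchanges it sits beside `outCell`, where yanking removes both.
    calc β.hcomp (.recvLeft a)
      _ ≈ᶜ (((PreCell.gen s).vcomp (outCell m a)).vcomp (.gen g)).hcomp
          (((PreCell.vid (𝟙_ C)).vcomp (.recvLeft a)).vcomp (.vid a)) :=
        .hcomp_congr h (.symm ((CellEq.vcomp_vid _).trans (.vid_vcomp _)))
      _ ≈ᶜ (((PreCell.gen s).vcomp (outCell m a)).hcomp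
          ((PreCell.vid (𝟙_ C)).vcomp (.recvLeft a))).vcomp ((PreCell.gen g).hcomp (.vid a)) :=
        .interchange _ _ _ _
      _ ≈ᶜ (((PreCell.gen s).hcomp (.vid (𝟙_ C))).vcomp
          ((outCell m a).hcomp (.recvLeft a))).vcomp ((PreCell.gen g).hcomp (.vid a)) :=
        .vcomp_congr (.interchange _ _ _ _) (.refl _)
      _ ≈ᶜ ((PreCell.gen s).vcomp (.vid (m ⊗ a))).vcomp (.gen (g ▷ a)) :=
        .vcomp_congr (.vcomp_congr (.hcomp_vid_unit _) (outCell_hcomp_recvLeft m a))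
          (CellEq.gen_whiskerRight g a).symm
      _ ≈ᶜ _ := .vcomp_congr (.vcomp_vid _) (.refl _)
  | recvRight a =>
    obtain ⟨g, h⟩ := h.exists_gen
    exact (step (l := (a, .bullet)) (c := c) (d := d ⊗ a) (g ▷ a)).congr
      ((gen_hcomp_recvRight g a).symm.trans (.hcomp_congr h.symm (.refl _)))
  | sendLeft a =>
    obtain ⟨m, s, g, h⟩ := h.exists_stepPre_vcomp_gen
    change c ⊗ a ⟶ m at s
    refine (gen (s ≫ g)).congr ((CellEq.gen_comp _ _).trans (.symm ?_))
    -- Here the corner goes to the top row, beside `inCell`.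
    calc β.hcomp (.sendLeft a)
      _ ≈ᶜ (((inCell c a).vcomp (.gen s)).vcomp (.gen g)).hcomp
          (((PreCell.sendLeft a).vcomp (.vid (𝟙_ C))).vcomp (.vid (𝟙_ C))) :=
        .hcomp_congr h (.symm ((CellEq.vcomp_vid _).trans (.vcomp_vid _)))
      _ ≈ᶜ (((inCell c a).vcomp (.gen s)).hcomp
          ((PreCell.sendLeft a).vcomp (.vid (𝟙_ C)))).vcomp
            ((PreCell.gen g).hcomp (.vid (𝟙_ C))) :=
        .interchange _ _ _ _
      _ ≈ᶜ (((inCell c a).hcomp (.sendLeft a)).vcomp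
          ((PreCell.gen s).hcomp (.vid (𝟙_ C)))).vcomp ((PreCell.gen g).hcomp (.vid (𝟙_ C))) :=
        .vcomp_congr (.interchange _ _ _ _) (.refl _)
      _ ≈ᶜ ((PreCell.vid (c ⊗ a)).vcomp (.gen s)).vcomp (.gen g) :=
        .vcomp_congr (.vcomp_congr (inCell_hcomp_sendLeft c a) (.hcomp_vid_unit _))
          (.hcomp_vid_unit _)
      _ ≈ᶜ _ := .vcomp_congr (.vid_vcomp _) (.refl _)
  | vid a =>
    obtain ⟨g, h⟩ := h.exists_gen
    exact (gen (g ▷ a)).congr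
      ((CellEq.gen_whiskerRight g a).trans (.hcomp_congr h.symm (.refl _)))
  | hid x => exact h.congr (CellEq.hcomp_hid β).symm
  | hcomp α α' ih ih' => exact (ih' (ih h)).congr (.hcomp_assoc _ _ _)
  | vcomp α α' ih ih' =>
    obtain ⟨m, β₁, β₂, h₁, h₂, e⟩ := h.exists_vcomp
    exact (vcomp (ih h₁) (ih' h₂)).congr
      ((CellEq.interchange _ _ _ _).symm.trans (.hcomp_congr e.symm (.refl _)))

/-- The identity of the unit is normal for the empty word and is neutral on the left of `α`. -/
theorem of_left_one {y : VEdge C} {a b : C} (α : PreCell C 1 a b y) : IsNormal y α :=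
  (((gen (𝟙 (𝟙_ C))).congr (.gen_id _)).hcomp α).congr (.vid_unit_hcomp α)

end IsNormal

theorem toothPre_comp {c m N a b : C} (s : c ⊗ a ⟶ m) (t : m ⟶ N ⊗ b) :
    toothPre (s ≫ t) ≈ᶜ (stepPre (a, .bullet) s).vcomp (stepPre (b, .circ) t) :=
  calc toothPre (s ≫ t)
    _ ≈ᶜ ((inCell c a).vcomp (.gen (s ≫ t))).vcomp (outCell N b) := toothPre_cellEq _
    _ ≈ᶜ ((inCell c a).vcomp ((PreCell.gen s).vcomp (.gen t))).vcomp (outCell N b) :=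
      .vcomp_congr (.vcomp_congr (.refl _) (.gen_comp _ _)) (.refl _)
    _ ≈ᶜ (((inCell c a).vcomp (.gen s)).vcomp (.gen t)).vcomp (outCell N b) :=
      .vcomp_congr (.symm (.vcomp_assoc _ _ _)) (.refl _)
    _ ≈ᶜ _ := .vcomp_assoc _ _ _

end

/-! ### Normal cells over alternating words are combs -/

section

variable {C : Type u} [Category.{v} C] [MonoidalCategory C]

local infix:50 " ≈ᶜ " => CellEq

/-- The sequence of objects `c, M₁, …, Mₖ, I, I, …`. -/
def startObj {k : ℕ} (c : C) (M : Fin k → C) : ℕ → C :=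
  padObj (Fin.cons c M : Fin (k + 1) → C)

/-- The set `∏ᵢ C(M_{i-1} ⊗ Aᵢ, Nᵢ ⊗ Bᵢ)` where `M₀ = c` and the last `Nᵢ` is the unit object. -/
abbrev FromTuple {k : ℕ} (A B : Fin (k + 1) → C) (c : C) (M N : Fin k → C) : Type v :=
  ∀ i : Fin (k + 1), startObj c M (i : ℕ) ⊗ A i ⟶ padObj N (i : ℕ) ⊗ B i

namespace FromTuple

/-- The tuple of a single morphism. -/
def single {A B : Fin 1 → C} {c : C} {M N : Fin 0 → C} (f : c ⊗ A 0 ⟶ 𝟙_ C ⊗ B 0) :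
    FromTuple A B c M N :=
  fun i => Fin.cases (motive := fun i : Fin 1 =>
    startObj c M (i : ℕ) ⊗ A i ⟶ padObj N (i : ℕ) ⊗ B i) f (fun i => i.elim0) i

/-- Prepend a morphism to a tuple. -/
def cons {k : ℕ} {A B : Fin (k + 2) → C} {c N N' : C} {M M' : Fin k → C}
    (f : c ⊗ A 0 ⟶ N' ⊗ B 0)
    (t : FromTuple (fun i => A i.succ) (fun i => B i.succ) N M M') :
    FromTuple A B c (Fin.cons N M : Fin (k + 1) → C) (Fin.cons N' M' : Fin (k + 1) → C) :=
  fun i => Fin.cases (motive := fun i : Fin (k + 2) =>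
    startObj c (Fin.cons N M : Fin (k + 1) → C) (i : ℕ) ⊗ A i ⟶
      padObj (Fin.cons N' M' : Fin (k + 1) → C) (i : ℕ) ⊗ B i) f t i

/-- A tuple that starts at the unit object. -/
def toTuple {k : ℕ} {A B : Fin (k + 1) → C} {M N : Fin k → C} (f : FromTuple A B (𝟙_ C) M N) :
    Tuple A B M N :=
  -- `startObj (𝟙_ C) M` and `(mem C k).obj M` agree by definition only after the index is split
  -- into zero and successor.
  fun i => Fin.cases (motive := fun i : Fin (k + 1) =>
    (mem C k).obj M (i : ℕ) ⊗ A i ⟶ (mem C k).obj N ((i : ℕ) + 1) ⊗ B i)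
    (f 0) (fun i => f i.succ) i

variable [StrictMonoidal C]

/-- The formal cell of a tuple. -/
def teethPre {k : ℕ} {A B : Fin (k + 1) → C} {c : C} {M : Fin k → C} (f : FromTuple A B c M M) :
    PreCell C 1 c (padObj M k) (altWord (k + 1) A B) :=
  FreeCornering.teethPre (k + 1) A B (startObj c M) f

theorem combPre_toTuple {k : ℕ} {A B : Fin (k + 1) → C} {M : Fin k → C}
    (f : FromTuple A B (𝟙_ C) M M) : combPre f.toTuple ≈ᶜ f.teethPre :=
  PreCell.cast_cellEq _ _ _ _ _

theorem teethPre_single {A B : Fin 1 → C} {c : C} {M : Fin 0 → C} (f : c ⊗ A 0 ⟶ 𝟙_ C ⊗ B 0) :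
    (single f : FromTuple A B c M M).teethPre ≈ᶜ toothPre f :=
  (teethPre_succ_cellEq 0 A B (startObj c M) (single f : FromTuple A B c M M)).trans
    (CellEq.vcomp_vid (toothPre f))

theorem teethPre_cons {k : ℕ} {A B : Fin (k + 2) → C} {c N : C} {M : Fin k → C}
    (f : c ⊗ A 0 ⟶ N ⊗ B 0) (t : FromTuple (fun i => A i.succ) (fun i => B i.succ) N M M) :
    (cons f t).teethPre ≈ᶜ (toothPre f).vcomp t.teethPre :=
  teethPre_succ_cellEq _ _ _ _ _

/-- The word is read two letters at a time: a receiving step followed by a sending step is a tooth,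
by `toothPre_comp`. -/
theorem exists_of_isNormal : ∀ {k : ℕ} {A B : Fin (k + 1) → C} {x : VEdge C} {c : C} {y : VEdge C}
    {β : PreCell C x c (𝟙_ C) y}, IsNormal (altWord (k + 1) A B) β →
    ∃ (M : Fin k → C) (f : FromTuple A B c M M), β ≈ᶜ f.teethPre
  | 0, A, B, x, c, y, β, h => by
    obtain ⟨m, s, β', h', e⟩ := IsNormal.exists_step (l := (A 0, .bullet)) h
    obtain ⟨N, t, β'', h'', e'⟩ := IsNormal.exists_step (l := (B 0, .circ)) h'
    obtain ⟨g, e''⟩ := IsNormal.exists_gen h''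
    change c ⊗ A 0 ⟶ m at s
    change m ⟶ N ⊗ B 0 at t
    -- The morphism `g` left after the last letter ends at the unit. Absorbing it into the last
    -- tooth makes the final memory object the unit.
    refine ⟨Fin.elim0, single ((s ≫ t) ≫ g ▷ B 0), .trans ?_ (teethPre_single _).symm⟩
    refine e.trans ((CellEq.vcomp_congr (.refl _) (e'.trans (.vcomp_congr (.refl _) e''))).trans
      ((CellEq.vcomp_assoc _ _ _).symm.trans ?_))
    refine (CellEq.vcomp_congr (toothPre_comp s t).symm (.refl _)).trans ?_
    exact (toothPre_comp_whiskerRight (s ≫ t) g).symm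
  | k + 1, A, B, x, c, y, β, h => by
    obtain ⟨m, s, β', h', e⟩ := IsNormal.exists_step (l := (A 0, .bullet)) h
    obtain ⟨N, t, β'', h'', e'⟩ := IsNormal.exists_step (l := (B 0, .circ)) h'
    change c ⊗ A 0 ⟶ m at s
    change m ⟶ N ⊗ B 0 at t
    obtain ⟨M, f, e''⟩ := exists_of_isNormal (k := k) (A := fun i => A i.succ)
      (B := fun i => B i.succ) h''
    refine ⟨Fin.cons N M, cons (s ≫ t) f, .trans ?_ (teethPre_cons _ _).symm⟩
    exact e.trans ((CellEq.vcomp_congr (.refl _) (e'.trans (.vcomp_congr (.refl _) e''))).trans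
      ((CellEq.vcomp_assoc _ _ _).symm.trans
        (.vcomp_congr (toothPre_comp s t).symm (.refl _))))

end FromTuple

theorem exists_comb_eq [StrictMonoidal C] {k : ℕ} {A B : Fin (k + 1) → C}
    (c : Cell C 1 (𝟙_ C) (𝟙_ C) (altWord (k + 1) A B)) :
    ∃ (M : Fin k → C) (f : Tuple A B M M), comb f = c := by
  induction c using Quotient.inductionOn with
  | _ α =>
    obtain ⟨M, f, h⟩ := FromTuple.exists_of_isNormal (IsNormal.of_left_one α)
    refine ⟨M, f.toTuple, (mk_combPre _).symm.trans (Cell.mk_eq_mk.2 ?_)⟩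
    exact (FromTuple.combPre_toTuple f).trans h.symm

end

/-! ### The double category of profunctors on `C` -/

section

variable {C : Type u} [Category.{v} C] [MonoidalCategory C]

namespace Step

/-- A step for `a°`. -/
def circ {a c d : C} (f : c ⟶ d ⊗ a) : Step (a, .circ) c d := f

/-- A step for `a•`. -/
def bullet {a c d : C} (f : c ⊗ a ⟶ d) : Step (a, .bullet) c d := f

theorem circ_surj {a c d : C} (s : Step (a, .circ) c d) : ∃ f, s = circ f := ⟨s, rfl⟩

theorem bullet_surj {a c d : C} (s : Step (a, .bullet) c d) : ∃ f, s = bullet f := ⟨s, rfl⟩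

theorem pre_circ {a c c' d : C} (m : c' ⟶ c) (f : c ⟶ d ⊗ a) :
    (circ f).pre _ m = circ (m ≫ f) := rfl

theorem pre_bullet {a c c' d : C} (m : c' ⟶ c) (f : c ⊗ a ⟶ d) :
    (bullet f).pre _ m = bullet (m ▷ a ≫ f) := rfl

theorem post_circ {a c d d' : C} (f : c ⟶ d ⊗ a) (m : d ⟶ d') :
    (circ f).post _ m = circ (f ≫ m ▷ a) := rfl

theorem post_bullet {a c d d' : C} (f : c ⊗ a ⟶ d) (m : d ⟶ d') :
    (bullet f).post _ m = bullet (f ≫ m) := rfl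

theorem pre_id : ∀ (l : C × Polarity) {c d : C} (s : Step l c d), s.pre l (𝟙 c) = s
  | (_, .circ), _, _, s => Category.id_comp s
  | (a, .bullet), c, d, s => (by simp : ∀ s : c ⊗ a ⟶ d, 𝟙 c ▷ a ≫ s = s) s

theorem pre_comp : ∀ (l : C × Polarity) {c c' c'' d : C} (m' : c'' ⟶ c') (m : c' ⟶ c)
    (s : Step l c d), s.pre l (m' ≫ m) = (s.pre l m).pre l m'
  | (_, .circ), _, _, _, _, m', m, s => Category.assoc m' m s
  | (a, .bullet), c, _, _, d, m', m, s =>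
    (by simp : ∀ s : c ⊗ a ⟶ d, (m' ≫ m) ▷ a ≫ s = m' ▷ a ≫ m ▷ a ≫ s) s

theorem post_comp : ∀ (l : C × Polarity) {c d d' d'' : C} (s : Step l c d) (m : d ⟶ d')
    (m' : d' ⟶ d''), s.post l (m ≫ m') = (s.post l m).post l m'
  | (a, .circ), c, d, _, _, s, m, m' =>
    (by simp : ∀ s : c ⟶ d ⊗ a, s ≫ (m ≫ m') ▷ a = (s ≫ m ▷ a) ≫ m' ▷ a) s
  | (_, .bullet), _, _, _, _, s, m, m' => (Category.assoc s m m').symm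

theorem pre_post : ∀ (l : C × Polarity) {c c' d d' : C} (m : c' ⟶ c) (s : Step l c d)
    (m' : d ⟶ d'), (s.post l m').pre l m = (s.pre l m).post l m'
  | (_, .circ), _, _, _, _, _, _, _ => (Category.assoc _ _ _).symm
  | (_, .bullet), _, _, _, _, _, _, _ => (Category.assoc _ _ _).symm

end Step

variable (C) in
/-- A presheaf on `C`, with values in a universe large enough to form coends over `C`. -/
structure Psh where
  /-- the values -/
  obj : C → Type (max u v)
  /-- the action of morphisms -/
  act : ∀ {c c' : C}, (c' ⟶ c) → obj c → obj c'
  act_id : ∀ {c : C} (q : obj c), act (𝟙 c) q = q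
  act_comp : ∀ {c c' c'' : C} (m' : c'' ⟶ c') (m : c' ⟶ c) (q : obj c),
    act (m' ≫ m) q = act m' (act m q)

namespace Psh

/-- A morphism of presheaves. -/
structure Hom (Q R : Psh C) where
  /-- the components -/
  app : ∀ {c : C}, Q.obj c → R.obj c
  act : ∀ {c c' : C} (m : c' ⟶ c) (q : Q.obj c), app (Q.act m q) = R.act m (app q)

/-- The presheaf represented by `e`. -/
def hom (e : C) : Psh C where
  obj c := ULift.{u} (c ⟶ e)
  act m f := ⟨m ≫ f.down⟩
  act_id f := by simp
  act_comp m' m f := by simp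

/-- The relation defining the coend `∫ᵈ Step l c d × Q d`. -/
inductive ExtRel (l : C × Polarity) (Q : Psh C) (c : C) :
    (Σ d, Step l c d × Q.obj d) → (Σ d, Step l c d × Q.obj d) → Prop
  | slide {d d' : C} (s : Step l c d) (m : d ⟶ d') (q : Q.obj d') :
      ExtRel l Q c ⟨d', s.post l m, q⟩ ⟨d, s, Q.act m q⟩

/-- The presheaf `c ↦ ∫ᵈ Step l c d × Q d`. -/
def ext (l : C × Polarity) (Q : Psh C) : Psh C where
  obj c := Quot (ExtRel l Q c)
  act m := Quot.map (fun t => ⟨t.1, t.2.1.pre l m, t.2.2⟩) fun _ _ h => by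
    cases h with
    | slide s m' q =>
      dsimp only
      rw [Step.pre_post]
      exact .slide _ _ _
  act_id q := by
    induction q using Quot.ind with
    | _ t => exact congrArg (fun s => Quot.mk (ExtRel l Q _) ⟨t.1, s, t.2.2⟩) (Step.pre_id l t.2.1)
  act_comp m' m q := by
    induction q using Quot.ind with
    | _ t =>
      exact congrArg (fun s => Quot.mk (ExtRel l Q _) ⟨t.1, s, t.2.2⟩)
        (Step.pre_comp l m' m t.2.1)

/-- The functoriality of `ext`. -/
def ext.map (l : C × Polarity) {Q R : Psh C} (φ : Hom Q R) : Hom (ext l Q) (ext l R) where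
  app := Quot.map (fun t => ⟨t.1, t.2.1, φ.app t.2.2⟩) fun _ _ h => by
    cases h with
    | slide s m' q =>
      dsimp only
      rw [φ.act]
      exact .slide _ _ _
  act m q := by
    induction q using Quot.ind with
    | _ t => rfl

end Psh

/-- The profunctor of a word, as a presheaf in its first variable. -/
def prof : List (C × Polarity) → C → Psh C
  | [], e => Psh.hom e
  | l :: w, e => Psh.ext l (prof w e)

/-- The action on the second variable of the profunctor of a word. -/
def profMap : ∀ (w : List (C × Polarity)) {e e' : C}, (e ⟶ e') → Psh.Hom (prof w e) (prof w e')
  | [], _, _, m => ⟨fun f => ⟨f.down ≫ m⟩, fun _ _ => congrArg ULift.up (Category.assoc _ _ _)⟩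
  | l :: w, _, _, m => Psh.ext.map l (profMap w m)

/-- The values of the profunctor of a word. -/
def Elt (w : VEdge C) (c e : C) : Type (max u v) := (prof w e).obj c

namespace Elt

/-- The contravariant action. -/
def pre {w : VEdge C} {c c' e : C} (m : c' ⟶ c) (p : Elt w c e) : Elt w c' e :=
  (prof w e).act m p

/-- The covariant action. -/
def post {w : VEdge C} {c e e' : C} (p : Elt w c e) (m : e ⟶ e') : Elt w c e' :=
  (profMap w m).app p

/-- A morphism, as an element of the profunctor of the empty word. -/
def nil {c e : C} (f : c ⟶ e) : Elt (1 : VEdge C) c e := ULift.up f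

/-- A step followed by an element of the profunctor of a word. -/
def cons {l : C × Polarity} {w : VEdge C} {c d e : C} (s : Step l c d) (p : Elt w d e) :
    Elt (FreeMonoid.of l * w) c e :=
  Quot.mk _ ⟨d, s, p⟩

theorem cons_post_left {l : C × Polarity} {w : VEdge C} {c d d' e : C} (s : Step l c d)
    (m : d ⟶ d') (p : Elt w d' e) : cons (s.post l m) p = cons s (pre m p) :=
  Quot.sound (.slide s m p)

/-- The morphism given by an element of the profunctor of the empty word. -/
def down {c e : C} (p : Elt (1 : VEdge C) c e) : c ⟶ e := ULift.down p

theorem down_nil {c e : C} (f : c ⟶ e) : (nil f).down = f := rfl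

theorem nil_surj {c e : C} (p : Elt (1 : VEdge C) c e) : ∃ f, p = nil f := ⟨p.down, rfl⟩

theorem cons_surj {l : C × Polarity} {w : VEdge C} {c e : C}
    (p : Elt (FreeMonoid.of l * w) c e) :
    ∃ (d : C) (s : Step l c d) (p' : Elt w d e), p = cons s p' := by
  induction p using Quot.ind with
  | _ t => exact ⟨t.1, t.2.1, t.2.2, rfl⟩

@[elab_as_elim]
theorem induction_on {motive : ∀ (w : VEdge C) (c e : C), Elt w c e → Prop}
    (nil : ∀ {c e : C} (f : c ⟶ e), motive 1 c e (nil f))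
    (cons : ∀ {l : C × Polarity} {w : VEdge C} {c d e : C} (s : Step l c d) (p : Elt w d e),
      motive w d e p → motive (FreeMonoid.of l * w) c e (cons s p))
    {w : VEdge C} {c e : C} (p : Elt w c e) : motive w c e p := by
  induction w generalizing c with
  | nil => exact nil (down p)
  | cons l w ih =>
    obtain ⟨d, s, p, rfl⟩ := cons_surj p
    exact cons s p (ih p)

theorem pre_nil {c c' e : C} (m : c' ⟶ c) (f : c ⟶ e) : pre m (nil f) = nil (m ≫ f) := rfl

theorem post_nil {c e e' : C} (f : c ⟶ e) (m : e ⟶ e') : post (nil f) m = nil (f ≫ m) := rfl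

theorem pre_cons {l : C × Polarity} {w : VEdge C} {c c' d e : C} (m : c' ⟶ c) (s : Step l c d)
    (p : Elt w d e) : pre m (cons s p) = cons (s.pre l m) p := rfl

theorem post_cons {l : C × Polarity} {w : VEdge C} {c d e e' : C} (s : Step l c d)
    (p : Elt w d e) (m : e ⟶ e') : post (cons s p) m = cons s (post p m) := rfl

theorem pre_id {w : VEdge C} {c e : C} (p : Elt w c e) : pre (𝟙 c) p = p :=
  (prof w e).act_id p

theorem pre_comp {w : VEdge C} {c c' c'' e : C} (m' : c'' ⟶ c') (m : c' ⟶ c) (p : Elt w c e) :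
    pre (m' ≫ m) p = pre m' (pre m p) :=
  (prof w e).act_comp m' m p

theorem pre_post {w : VEdge C} {c c' e e' : C} (m : c' ⟶ c) (p : Elt w c e) (m' : e ⟶ e') :
    pre m (post p m') = post (pre m p) m' :=
  ((profMap w m').act m p).symm

theorem post_id {w : VEdge C} {c e : C} (p : Elt w c e) : post p (𝟙 e) = p := by
  induction p using induction_on with
  | nil f => rw [post_nil, Category.comp_id]
  | cons s p ih => rw [post_cons, ih]

theorem post_comp {w : VEdge C} {c e e' e'' : C} (p : Elt w c e) (m : e ⟶ e') (m' : e' ⟶ e'') :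
    post p (m ≫ m') = post (post p m) m' := by
  induction p using induction_on with
  | nil f => simp only [post_nil, Category.assoc]
  | cons s p ih => simp only [post_cons, ih]

/-- Composition with a fixed element, as a morphism of presheaves. -/
def appendHom : ∀ (x : List (C × Polarity)) {z : VEdge C} {d e : C} (_ : Elt z d e),
    Psh.Hom (prof x d) (prof (FreeMonoid.ofList x * z : VEdge C) e)
  | [], _, _, _, q => ⟨fun f => pre f.down q, fun m f => pre_comp m f.down q⟩
  | l :: x, _, _, _, q => Psh.ext.map l (appendHom x q)

/-- The composition of elements of the profunctors of two words. -/
def append {x z : VEdge C} {c d e : C} (p : Elt x c d) (q : Elt z d e) : Elt (x * z) c e :=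
  (appendHom x q).app p

theorem nil_append {z : VEdge C} {c d e : C} (f : c ⟶ d) (q : Elt z d e) :
    append (nil f) q = pre f q := rfl

theorem pre_append {x z : VEdge C} {c c' d e : C} (m : c' ⟶ c) (p : Elt x c d) (q : Elt z d e) :
    pre m (append p q) = append (pre m p) q :=
  ((appendHom x q).act m p).symm

theorem append_post {x z : VEdge C} {c d e e' : C} (p : Elt x c d) (q : Elt z d e)
    (m : e ⟶ e') : post (append p q) m = append p (post q m) := by
  induction p using induction_on with
  | nil f => exact (pre_post f q m).symm
  | cons s p ih => exact congrArg (cons s) (ih q)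

theorem append_slide {x z : VEdge C} {c d d' e : C} (p : Elt x c d) (m : d ⟶ d')
    (q : Elt z d' e) : append (post p m) q = append p (pre m q) := by
  induction p using induction_on with
  | nil f => rw [post_nil, nil_append, nil_append, pre_comp]
  | cons s p ih => exact congrArg (cons s) (ih m)

theorem append_surj {x z : VEdge C} {c e : C} (r : Elt (x * z) c e) :
    ∃ (d : C) (p : Elt x c d) (q : Elt z d e), r = append p q := by
  induction x using FreeMonoid.recOn generalizing c with
  | one => exact ⟨c, nil (𝟙 c), r, (pre_id r).symm⟩
  | of_mul l x ih =>
    obtain ⟨d, s, r, rfl⟩ := cons_surj (w := x * z) r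
    obtain ⟨d', p, q, rfl⟩ := ih r
    exact ⟨d', cons s p, q, rfl⟩

/-- The universal property of `cons`. -/
def liftCons {T : Type*} {l : C × Polarity} {w : VEdge C} {c e : C}
    (F : ∀ {d : C}, Step l c d → Elt w d e → T)
    (hF : ∀ {d d' : C} (s : Step l c d) (m : d ⟶ d') (p : Elt w d' e),
      F (s.post l m) p = F s (pre m p)) : Elt (FreeMonoid.of l * w) c e → T :=
  Quot.lift (fun t => F t.2.1 t.2.2) fun _ _ h => by
    cases h with
    | slide s m p => exact hF s m p

/-- Universal property of the composite profunctor: a family compatible with sliding between `p` and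
`q` factors through `append`. Uniqueness is `append_surj`. -/
theorem exists_lift {T : Type*} {x z : VEdge C} {c e : C}
    (F : ∀ {d : C}, Elt x c d → Elt z d e → T)
    (hF : ∀ {d d' : C} (p : Elt x c d) (m : d ⟶ d') (q : Elt z d' e),
      F (post p m) q = F p (pre m q)) :
    ∃ L : Elt (x * z) c e → T, ∀ {d : C} (p : Elt x c d) (q : Elt z d e),
      L (append p q) = F p q := by
  induction x using FreeMonoid.recOn generalizing c with
  | one =>
    refine ⟨fun r => F (nil (𝟙 c)) r, fun p q => ?_⟩
    obtain ⟨f, rfl⟩ := nil_surj p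
    exact (hF (nil (𝟙 c)) f q).symm.trans (by rw [post_nil, Category.id_comp])
  | of_mul l x ih =>
    -- With the first step fixed, the induction hypothesis extends the family over the rest of the
    -- word; these extensions are then glued along the coend for the first letter.
    have h {d : C} (s : Step l c d) := ih (F := fun p q => F (cons s p) q)
      (fun p m q => hF (cons s p) m q)
    choose L hL using @h
    refine ⟨liftCons (w := x * z) L fun s m r => ?_, fun p q => ?_⟩
    · obtain ⟨d, p, q, rfl⟩ := append_surj r
      rw [pre_append, hL, hL, cons_post_left]
    · obtain ⟨d, s, p, rfl⟩ := cons_surj p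
      exact hL s p q

/-- A step followed by a morphism. -/
def single {l : C × Polarity} {c d e : C} (s : Step l c d) (g : d ⟶ e) :
    Elt (FreeMonoid.of l) c e :=
  cons s (nil g)

theorem pre_single {l : C × Polarity} {c c' d e : C} (m : c' ⟶ c) (s : Step l c d) (g : d ⟶ e) :
    pre m (single s g) = single (s.pre l m) g := rfl

theorem post_single {l : C × Polarity} {c d e e' : C} (s : Step l c d) (g : d ⟶ e)
    (m : e ⟶ e') : post (single s g) m = single s (g ≫ m) := rfl

theorem single_post_left {l : C × Polarity} {c d d' e : C} (s : Step l c d) (m : d ⟶ d')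
    (g : d' ⟶ e) : single (s.post l m) g = single s (m ≫ g) :=
  cons_post_left s m (nil g)

/-- Co-Yoneda for one letter: the trailing morphism is absorbed into the step. -/
theorem single_surj {l : C × Polarity} {c e : C} (p : Elt (FreeMonoid.of l) c e) :
    ∃ s : Step l c e, p = single s (𝟙 e) := by
  obtain ⟨d, s, p', rfl⟩ := cons_surj (w := 1) p
  obtain ⟨g, rfl⟩ := nil_surj p'
  refine ⟨s.post l g, ?_⟩
  rw [single_post_left, Category.comp_id]
  rfl

/-- The step given by an element of the profunctor of a one-letter word. -/
def toStep {l : C × Polarity} {c d : C} : Elt (FreeMonoid.of l) c d → Step l c d :=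
  Quot.lift (fun t => t.2.1.post l (ULift.down t.2.2)) fun _ _ h => by
    cases h with
    | slide s m q => exact (Step.post_comp l s m q.down).symm

theorem toStep_pre {l : C × Polarity} {c c' d : C} (m : c' ⟶ c) (p : Elt (FreeMonoid.of l) c d) :
    toStep (pre m p) = (toStep p).pre l m := by
  induction p using Quot.ind with
  | _ t => exact (Step.pre_post l m t.2.1 (ULift.down t.2.2)).symm

theorem toStep_post {l : C × Polarity} {c d d' : C} (p : Elt (FreeMonoid.of l) c d)
    (m : d ⟶ d') : toStep (post p m) = (toStep p).post l m := by
  induction p using Quot.ind with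
  | _ t => exact Step.post_comp l t.2.1 (ULift.down t.2.2) m

end Elt

/-- The cells of the double category of profunctors on `C`: natural families
`P c d → Q (c ⊗ a) (d ⊗ b)` where `P` and `Q` are the profunctors of two words. -/
structure Transf (x : VEdge C) (a b : C) (y : VEdge C) where
  /-- the components -/
  app : ∀ {c d : C}, Elt x c d → Elt y (c ⊗ a) (d ⊗ b)
  pre : ∀ {c c' d : C} (m : c' ⟶ c) (p : Elt x c d), app (p.pre m) = (app p).pre (m ▷ a)
  post : ∀ {c d d' : C} (p : Elt x c d) (m : d ⟶ d'), app (p.post m) = (app p).post (m ▷ b)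

namespace Transf

/-- The transformation given by a morphism. -/
def gen {a b : C} (f : a ⟶ b) : Transf (1 : VEdge C) a b 1 where
  app p := .nil (p.down ⊗ₘ f)
  pre m p := by
    obtain ⟨g, rfl⟩ := p.nil_surj
    simp [Elt.pre_nil, Elt.down_nil, MonoidalCategory.tensorHom_def]
  post p m := by
    obtain ⟨g, rfl⟩ := p.nil_surj
    simp [Elt.post_nil, Elt.down_nil, MonoidalCategory.tensorHom_def']

/-- The interpretation of the corner that sends `a` to the right. -/
def sendRight (a : C) : Transf 1 a (𝟙_ C) (circ a) where
  app {c d} p := .single (.circ (p.down ▷ a)) (ρ_ d).inv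
  pre m p := by
    obtain ⟨g, rfl⟩ := p.nil_surj
    rw [Elt.pre_single, Elt.pre_nil, Elt.down_nil, Elt.down_nil, comp_whiskerRight,
      Step.pre_circ]
  post {c d d'} p m := by
    obtain ⟨g, rfl⟩ := p.nil_surj
    rw [Elt.post_single, Elt.post_nil, Elt.down_nil, Elt.down_nil,
      ← rightUnitor_inv_naturality, ← Elt.single_post_left, comp_whiskerRight,
      Step.post_circ]

/-- The interpretation of the corner that receives `a` from the left. -/
def recvLeft (a : C) : Transf (circ a) (𝟙_ C) a 1 where
  app {c d} p := .nil ((ρ_ c).hom ≫ (show c ⟶ d ⊗ a from p.toStep))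
  pre m p := by
    rw [Elt.toStep_pre, Elt.pre_nil, rightUnitor_naturality_assoc]
    rfl
  post p m := by
    rw [Elt.toStep_post, Elt.post_nil, Category.assoc]
    rfl

/-- The interpretation of the corner that receives `a` from the right. -/
def recvRight (a : C) : Transf 1 (𝟙_ C) a (bullet a) where
  app {c d} p := .single (.bullet (((ρ_ c).hom ≫ p.down) ▷ a)) (𝟙 (d ⊗ a))
  pre {c c' d} m p := by
    obtain ⟨g, rfl⟩ := p.nil_surj
    rw [Elt.pre_single, Elt.pre_nil, Elt.down_nil, Elt.down_nil, ← rightUnitor_naturality_assoc,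
      comp_whiskerRight, Step.pre_bullet]
  post {c d d'} p m := by
    obtain ⟨g, rfl⟩ := p.nil_surj
    rw [Elt.post_single, Elt.post_nil, Elt.down_nil, Elt.down_nil, Category.id_comp,
      ← Category.comp_id (m ▷ a), ← Elt.single_post_left, ← Category.assoc, comp_whiskerRight,
      Step.post_bullet]

/-- The interpretation of the corner that sends `a` to the left. -/
def sendLeft (a : C) : Transf (bullet a) a (𝟙_ C) 1 where
  app {c d} p := .nil ((show c ⊗ a ⟶ d from p.toStep) ≫ (ρ_ d).inv)
  pre m p := by
    rw [Elt.toStep_pre, Elt.pre_nil, ← Category.assoc]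
    rfl
  post {c d d'} p m := by
    rw [Elt.toStep_post, Elt.post_nil, Category.assoc, ← rightUnitor_inv_naturality,
      ← Category.assoc]
    rfl

/-- The horizontal identity. -/
def hid (x : VEdge C) : Transf x (𝟙_ C) (𝟙_ C) x where
  app {c d} p := (p.pre (ρ_ c).hom).post (ρ_ d).inv
  pre m p := by
    rw [← Elt.pre_comp, ← rightUnitor_naturality, Elt.pre_comp, Elt.pre_post]
  post p m := by
    rw [← Elt.post_comp, ← rightUnitor_inv_naturality, Elt.post_comp, Elt.pre_post]

/-- Horizontal composition. -/
def hcomp {x y z : VEdge C} {a b c d : C} (φ : Transf x a b y) (ψ : Transf y c d z) :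
    Transf x (a ⊗ c) (b ⊗ d) z where
  app {e g} p := ((ψ.app (φ.app p)).pre (α_ e a c).inv).post (α_ g b d).hom
  pre m p := by
    rw [φ.pre, ψ.pre, ← Elt.pre_comp, ← associator_inv_naturality_left, Elt.pre_comp,
      Elt.pre_post]
  post p m := by
    rw [φ.post, ψ.post, Elt.pre_post, ← Elt.post_comp, associator_naturality_left,
      Elt.post_comp]

section

variable {x y z w : VEdge C} {a b c : C} (φ : Transf x a b y) (ψ : Transf z b c w)

/-- A morphism slid between `p` and `q` becomes, by naturality of `φ` and `ψ`, its whiskering with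
the common edge `b`, which slides between the images. -/
theorem exists_vcompApp (e g : C) :
    ∃ L : Elt (x * z) e g → Elt (y * w) (e ⊗ a) (g ⊗ c), ∀ {d : C} (p : Elt x e d)
      (q : Elt z d g), L (p.append q) = (φ.app p).append (ψ.app q) :=
  Elt.exists_lift (fun p q => (φ.app p).append (ψ.app q)) fun p m q => by
    rw [φ.post, ψ.pre, Elt.append_slide]

/-- Vertical composition. -/
noncomputable def vcomp : Transf (x * z) a c (y * w) where
  app {e g} := (exists_vcompApp φ ψ e g).choose
  pre m r := by
    obtain ⟨d, p, q, rfl⟩ := r.append_surj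
    rw [Elt.pre_append, (exists_vcompApp φ ψ _ _).choose_spec,
      (exists_vcompApp φ ψ _ _).choose_spec, φ.pre, Elt.pre_append]
  post r m := by
    obtain ⟨d, p, q, rfl⟩ := r.append_surj
    rw [Elt.append_post, (exists_vcompApp φ ψ _ _).choose_spec,
      (exists_vcompApp φ ψ _ _).choose_spec, ψ.post, Elt.append_post]

theorem vcomp_append {d e g : C} (p : Elt x e d) (q : Elt z d g) :
    (vcomp φ ψ).app (p.append q) = (φ.app p).append (ψ.app q) :=
  (exists_vcompApp φ ψ e g).choose_spec p q

end

end Transf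

/-- The interpretation of formal cells in the double category of profunctors on `C`. -/
noncomputable def PreCell.interp : ∀ {x : VEdge C} {a b : C} {y : VEdge C},
    PreCell C x a b y → Transf x a b y
  | _, _, _, _, .gen f => .gen f
  | _, _, _, _, .sendRight a => .sendRight a
  | _, _, _, _, .recvLeft a => .recvLeft a
  | _, _, _, _, .recvRight a => .recvRight a
  | _, _, _, _, .sendLeft a => .sendLeft a
  | _, _, _, _, .vid a => .gen (𝟙 a)
  | _, _, _, _, .hid x => .hid x
  | _, _, _, _, .hcomp α β => .hcomp α.interp β.interp
  | _, _, _, _, .vcomp α β => .vcomp α.interp β.interp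

end

/-! ### Soundness of the interpretation -/

section

variable {C : Type u} [Category.{v} C] [MonoidalCategory C]

local infix:50 " ≈ᶜ " => CellEq

/-- Equality of elements of the profunctors of possibly different words, at possibly different
objects. -/
inductive Elt.Same {w : VEdge C} {c e : C} (p : Elt w c e) :
    ∀ {w' : VEdge C} {c' e' : C}, Elt w' c' e' → Prop
  | refl : Elt.Same p p

local infix:50 " ≈ᵉ " => Elt.Same

namespace Elt.Same

variable {w w' w'' : VEdge C} {c c' c'' e e' e'' : C}

theorem symm {p : Elt w c e} {p' : Elt w' c' e'} (h : p ≈ᵉ p') : p' ≈ᵉ p := by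
  cases h
  exact .refl

theorem trans {p : Elt w c e} {p' : Elt w' c' e'} {p'' : Elt w'' c'' e''} (h : p ≈ᵉ p')
    (h' : p' ≈ᵉ p'') : p ≈ᵉ p'' := by
  cases h
  exact h'

theorem of_eq {p p' : Elt w c e} (h : p = p') : p ≈ᵉ p' := by
  cases h
  exact .refl

theorem eq {p p' : Elt w c e} (h : p ≈ᵉ p') : p = p' := by
  cases h
  rfl

theorem append {x x' : VEdge C} {p : Elt x c e} {p' : Elt x' c' e'} {d d' : C} {q : Elt w e d}
    {q' : Elt w' e' d'} (h : p ≈ᵉ p') (h' : q ≈ᵉ q') : p.append q ≈ᵉ p'.append q' := by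
  cases h
  cases h'
  exact .refl

theorem cons {l : C × Polarity} {d : C} {s : Step l d c} {q : Elt w c e} {q' : Elt w' c e'}
    (h : q ≈ᵉ q') : Elt.cons s q ≈ᵉ Elt.cons s q' := by
  cases h
  exact .refl

theorem app {a b : C} {y : VEdge C} (φ : Transf w a b y) {p : Elt w c e} {p' : Elt w c' e'}
    (h : p ≈ᵉ p') : φ.app p ≈ᵉ φ.app p' := by
  cases h
  exact .refl

theorem append_nil {d : C} (p : Elt w c e) (f : e ⟶ d) : p.append (.nil f) ≈ᵉ p.post f := by
  induction p using Elt.induction_on with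
  | nil g => exact .refl
  | cons s p ih => exact cons (ih f)

theorem append_assoc {x y z : VEdge C} {c d e g : C} (p : Elt x c d) (q : Elt y d e)
    (r : Elt z e g) : (p.append q).append r ≈ᵉ p.append (q.append r) := by
  induction p using Elt.induction_on with
  | nil f => exact .of_eq (Elt.pre_append f q r).symm
  | cons s p ih => exact cons (ih q)

end Elt.Same

/-- The morphisms that are identities up to equality of objects. -/
def IsEqToHom {c d : C} (f : c ⟶ d) : Prop := ∃ h : c = d, f = eqToHom h

namespace IsEqToHom

theorem whiskerRight {c d : C} {f : c ⟶ d} (hf : IsEqToHom f) (a : C) : IsEqToHom (f ▷ a) := by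
  obtain ⟨rfl, rfl⟩ := hf
  exact ⟨rfl, by simp⟩

variable [StrictMonoidal C]

theorem associator_hom (a b c : C) : IsEqToHom (α_ a b c).hom :=
  ⟨StrictMonoidal.tensor_assoc a b c, by rw [StrictMonoidal.associator_eqToIso]; rfl⟩

theorem associator_inv (a b c : C) : IsEqToHom (α_ a b c).inv :=
  ⟨(StrictMonoidal.tensor_assoc a b c).symm, by rw [StrictMonoidal.associator_eqToIso]; rfl⟩

theorem leftUnitor_hom (a : C) : IsEqToHom (λ_ a).hom :=
  ⟨StrictMonoidal.unit_tensor a, by rw [StrictMonoidal.leftUnitor_eqToIso]; rfl⟩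

theorem leftUnitor_inv (a : C) : IsEqToHom (λ_ a).inv :=
  ⟨(StrictMonoidal.unit_tensor a).symm, by rw [StrictMonoidal.leftUnitor_eqToIso]; rfl⟩

theorem rightUnitor_hom (a : C) : IsEqToHom (ρ_ a).hom :=
  ⟨StrictMonoidal.tensor_unit a, by rw [StrictMonoidal.rightUnitor_eqToIso]; rfl⟩

theorem rightUnitor_inv (a : C) : IsEqToHom (ρ_ a).inv :=
  ⟨(StrictMonoidal.tensor_unit a).symm, by rw [StrictMonoidal.rightUnitor_eqToIso]; rfl⟩

end IsEqToHom

namespace Elt.Same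

theorem pre {w : VEdge C} {c c' e : C} {f : c' ⟶ c} (hf : IsEqToHom f) (p : Elt w c e) :
    p.pre f ≈ᵉ p := by
  obtain ⟨rfl, rfl⟩ := hf
  exact .of_eq p.pre_id

theorem post {w : VEdge C} {c e e' : C} {f : e ⟶ e'} (hf : IsEqToHom f) (p : Elt w c e) :
    p.post f ≈ᵉ p := by
  obtain ⟨rfl, rfl⟩ := hf
  exact .of_eq p.post_id

/-- Over a strict monoidal category, composing with structural isomorphisms does not change an
element up to `Elt.Same`. Axioms thus reduce to honest equalities in which these isomorphisms are
explicit. -/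
theorem of_eq_pre_post {w : VEdge C} {c c' e e' : C} {f : c' ⟶ c} (hf : IsEqToHom f)
    {g : e ⟶ e'} (hg : IsEqToHom g) {p : Elt w c' e'} {p' : Elt w c e}
    (h : p = (p'.post g).pre f) : p ≈ᵉ p' :=
  (of_eq h).trans ((pre hf _).trans (post hg _))

end Elt.Same

namespace Transf

theorem gen_nil {a b c d : C} (f : a ⟶ b) (g : c ⟶ d) :
    (gen f).app (.nil g) = .nil (g ⊗ₘ f) := rfl

/-- Equality of transformations with possibly different boundaries. -/
def Same {x y x' y' : VEdge C} {a b a' b' : C} (φ : Transf x a b y) (φ' : Transf x' a' b' y') :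
    Prop :=
  x = x' ∧ ∀ {c d c' d' : C} (p : Elt x c d) (p' : Elt x' c' d'), p ≈ᵉ p' → φ.app p ≈ᵉ φ'.app p'

theorem Same.mk {x y y' : VEdge C} {a b a' b' : C} {φ : Transf x a b y}
    {φ' : Transf x a' b' y'} (h : ∀ {c d : C} (p : Elt x c d), φ.app p ≈ᵉ φ'.app p) :
    Same φ φ' :=
  ⟨rfl, fun p _ e => (h p).trans (e.app φ')⟩

/-- For axioms whose words agree only by associativity or unitality: a convenient representative,
typically an `append`, may be chosen on one side. -/
theorem Same.of_exists {x y x' y' : VEdge C} {a b a' b' : C} {φ : Transf x a b y}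
    {φ' : Transf x' a' b' y'} (hx : x = x')
    (h : ∀ {c d : C} (p' : Elt x' c d), ∃ p : Elt x c d, p ≈ᵉ p' ∧ φ.app p ≈ᵉ φ'.app p') :
    Same φ φ' := by
  subst hx
  refine .mk fun p' => ?_
  obtain ⟨p, hp, h⟩ := h p'
  rwa [hp.eq] at h

variable [StrictMonoidal C]

theorem hid_app {x : VEdge C} {c d : C} (p : Elt x c d) : (hid x).app p ≈ᵉ p :=
  (Elt.Same.post (.rightUnitor_inv d) _).trans (.pre (.rightUnitor_hom c) p)

/-- Up to `Elt.Same`, horizontal composition is composition of functions, which makes its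
associativity and unit laws immediate. -/
theorem hcomp_app {x y z : VEdge C} {a b c d e g : C} (φ : Transf x a b y) (ψ : Transf y c d z)
    (p : Elt x e g) : (hcomp φ ψ).app p ≈ᵉ ψ.app (φ.app p) :=
  (Elt.Same.post (.associator_hom _ _ _) _).trans (.pre (.associator_inv _ _ _) _)

end Transf

open Transf in
/-- Equal formal cells have the same interpretation. -/
theorem CellEq.interp_same [StrictMonoidal C] {x y x' y' : VEdge C} {a b a' b' : C}
    {α : PreCell C x a b y} {α' : PreCell C x' a' b' y'} (h : α ≈ᶜ α') :
    α.interp.Same α'.interp := by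
  induction h with
  | refl α => exact .mk fun p => .refl
  | symm _ ih => exact ⟨ih.1.symm, fun p p' e => (ih.2 p' p e.symm).symm⟩
  | trans _ _ ih ih' =>
    obtain ⟨rfl, ih⟩ := ih
    exact ⟨ih'.1, fun p p'' e => (ih p p .refl).trans (ih'.2 p p'' e)⟩
  | hcomp_congr _ _ ih ih' =>
    exact ⟨ih.1, fun p p' e => (hcomp_app _ _ p).trans
      ((ih'.2 _ _ (ih.2 p p' e)).trans (hcomp_app _ _ p').symm)⟩
  | vcomp_congr _ _ ih ih' =>
    obtain ⟨rfl, ih⟩ := ih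
    obtain ⟨rfl, ih'⟩ := ih'
    refine .mk fun r => ?_
    obtain ⟨d, p, q, rfl⟩ := r.append_surj
    rw [PreCell.interp, PreCell.interp, vcomp_append, vcomp_append]
    exact (ih p p .refl).append (ih' q q .refl)
  | hcomp_assoc α β γ =>
    exact .mk fun p => (hcomp_app _ _ _).trans (((hcomp_app _ _ _).app _).trans
      ((hcomp_app α.interp (β.hcomp γ).interp p).trans (hcomp_app _ _ _)).symm)
  | hid_hcomp α => exact .mk fun p => (hcomp_app _ _ _).trans ((hid_app p).app _)
  | hcomp_hid α => exact .mk fun p => (hcomp_app _ _ _).trans (hid_app _)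
  | vcomp_assoc α β γ =>
    refine .of_exists (mul_assoc _ _ _) fun r => ?_
    obtain ⟨_, p₁, r, rfl⟩ := r.append_surj
    obtain ⟨_, p₂, p₃, rfl⟩ := r.append_surj
    refine ⟨_, .append_assoc p₁ p₂ p₃, ?_⟩
    simp only [PreCell.interp, vcomp_append]
    exact .append_assoc _ _ _
  | vid_vcomp α =>
    refine .mk fun {c d} p => ?_
    -- `vcomp` is known only on appended elements, so `p` is viewed as an identity followed by `p`.
    have h := vcomp_append (gen (𝟙 _)) α.interp (.nil (𝟙 c)) p
    refine ((Elt.Same.of_eq p.pre_id.symm).app _).trans ((Elt.Same.of_eq h).trans ?_)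
    rw [gen_nil, id_tensorHom_id]
    exact .of_eq (Elt.pre_id _)
  | vcomp_vid α =>
    refine .of_exists (mul_one _) fun {c d} p => ⟨p.append (.nil (𝟙 d)), ?_, ?_⟩
    · exact (Elt.Same.append_nil p _).trans (.of_eq p.post_id)
    · refine (Elt.Same.of_eq (vcomp_append α.interp (gen (𝟙 _)) p (.nil (𝟙 d)))).trans ?_
      rw [gen_nil, id_tensorHom_id]
      exact (Elt.Same.append_nil _ _).trans (.of_eq (Elt.post_id _))
  | vid_tensor a b =>
    refine .mk fun {c d} p => .trans ?_ (hcomp_app _ _ _).symm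
    obtain ⟨f, rfl⟩ := p.nil_surj
    refine .of_eq_pre_post (.associator_inv c a b) (.associator_hom d a b) ?_
    simp only [PreCell.interp, gen_nil, Elt.post_nil, Elt.pre_nil]
    simp
  | hid_mul x y =>
    refine .mk fun r => ?_
    obtain ⟨d, p, q, rfl⟩ := r.append_surj
    exact (hid_app _).trans (((hid_app p).symm.append (hid_app q).symm).trans
      (.of_eq (vcomp_append (hid x) (hid y) p q).symm))
  | hid_one =>
    refine .mk fun {c d} p => (hid_app p).trans (.symm ?_)
    obtain ⟨f, rfl⟩ := p.nil_surj
    refine .of_eq_pre_post (.rightUnitor_hom c) (.rightUnitor_inv d) ?_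
    simp only [PreCell.interp, gen_nil, Elt.post_nil, Elt.pre_nil]
    simp
  | interchange α β γ δ =>
    refine .mk fun r => ?_
    obtain ⟨d, p, q, rfl⟩ := r.append_surj
    have h := vcomp_append α.interp β.interp p q
    have h' := vcomp_append γ.interp δ.interp (α.interp.app p) (β.interp.app q)
    have h'' := vcomp_append (α.hcomp γ).interp (β.hcomp δ).interp p q
    exact (hcomp_app _ _ _).trans (((Elt.Same.of_eq h).app _).trans ((Elt.Same.of_eq h').trans
      (((hcomp_app _ _ _).append (hcomp_app _ _ _)).symm.trans (.of_eq h''.symm))))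
  | gen_id a => exact .mk fun p => .refl
  | gen_comp f g =>
    refine .mk fun {c d} p => ?_
    obtain ⟨h, rfl⟩ := p.nil_surj
    have e := vcomp_append (gen f) (gen g) (.nil h) (.nil (𝟙 d))
    rw [Elt.nil_append, Elt.pre_nil, Category.comp_id] at e
    refine .trans (.of_eq ?_) (Elt.Same.of_eq e).symm
    simp only [PreCell.interp, gen_nil, Elt.nil_append, Elt.pre_nil]
    simp [MonoidalCategory.tensorHom_def]
  | gen_tensor f g =>
    refine .mk fun {c d} p => .trans ?_ (hcomp_app _ _ _).symm
    obtain ⟨h, rfl⟩ := p.nil_surj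
    refine .of_eq_pre_post (.associator_inv _ _ _) (.associator_hom _ _ _) ?_
    simp only [PreCell.interp, gen_nil, Elt.post_nil, Elt.pre_nil]
    simp
  | yank_circ_hcomp a =>
    refine .mk fun {c d} p => .trans (hcomp_app _ _ _) ?_
    obtain ⟨f, rfl⟩ := p.nil_surj
    refine .of_eq_pre_post (.rightUnitor_hom _) ((IsEqToHom.rightUnitor_inv d).whiskerRight a) ?_
    simp only [PreCell.interp, gen_nil, Elt.post_nil, Elt.pre_nil, tensorHom_id]
    rfl
  | yank_circ_vcomp a =>
    refine .of_exists (mul_one _) fun {c d} p => ⟨p.append (.nil (𝟙 d)), ?_, ?_⟩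
    · exact (Elt.Same.append_nil p _).trans (.of_eq p.post_id)
    · refine (Elt.Same.of_eq (vcomp_append (recvLeft a) (sendRight a) p (.nil (𝟙 d)))).trans
        (.of_eq ?_)
      obtain ⟨s, rfl⟩ := p.single_surj
      obtain ⟨f, hf⟩ := s.circ_surj
      rw [hf]
      change ((Elt.single (Step.circ (𝟙 d ▷ a)) (ρ_ d).inv).pre
        ((ρ_ c).hom ≫ f ≫ 𝟙 d ▷ a)) =
          ((Elt.single (Step.circ f) (𝟙 d)).pre (ρ_ c).hom).post (ρ_ d).inv
      simp [Elt.pre_single, Elt.post_single, Step.pre_circ]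
  | yank_bullet_hcomp a =>
    refine .mk fun {c d} p => .trans (hcomp_app _ _ _) ?_
    obtain ⟨f, rfl⟩ := p.nil_surj
    refine .of_eq_pre_post ((IsEqToHom.rightUnitor_hom c).whiskerRight a)
      (.rightUnitor_inv (d ⊗ a)) ?_
    change Elt.nil ((((ρ_ c).hom ≫ f) ▷ a ≫ 𝟙 (d ⊗ a)) ≫ (ρ_ (d ⊗ a)).inv) =
      ((Elt.nil (f ⊗ₘ 𝟙 a)).post _).pre _
    simp [Elt.post_nil, Elt.pre_nil]
  | yank_bullet_vcomp a =>
    refine .mk fun {c d} p => ?_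
    have h := vcomp_append (recvRight a) (sendLeft a) (.nil (𝟙 c)) p
    refine ((Elt.Same.of_eq p.pre_id.symm).app _).trans ((Elt.Same.of_eq h).trans (.of_eq ?_))
    obtain ⟨s, rfl⟩ := p.single_surj
    obtain ⟨f, hf⟩ := s.bullet_surj
    rw [hf]
    change Elt.single (Step.bullet (((ρ_ c).hom ≫ 𝟙 c) ▷ a))
        (𝟙 (c ⊗ a) ≫ (f ≫ 𝟙 d) ≫ (ρ_ d).inv) =
      ((Elt.single (Step.bullet f) (𝟙 d)).pre (ρ_ c).hom).post (ρ_ d).inv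
    -- The coend relation moves `f` out of the receiving step into the trailing morphism.
    rw [Elt.pre_single, Elt.post_single, Step.pre_bullet, ← Step.post_bullet,
      Elt.single_post_left]
    simp

end

/-! ### Evaluation of combs in the model -/

section

variable {C : Type u} [Category.{v} C] [MonoidalCategory C]

local infix:50 " ≈ᶜ " => CellEq
local infix:50 " ≈ᵉ " => Elt.Same

namespace Elt

/-- The element given by a tooth. -/
def tooth {M N a b : C} (f : M ⊗ a ⟶ N ⊗ b) : Elt (bullet a * circ b) M N :=
  cons (Step.bullet (𝟙 (M ⊗ a))) (single (Step.circ f) (𝟙 N))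

theorem tooth_append {w : VEdge C} {M N a b e : C} (f : M ⊗ a ⟶ N ⊗ b) (q : Elt w N e) :
    append (tooth f) q = cons (Step.bullet (𝟙 (M ⊗ a))) (cons (Step.circ f) q) := by
  conv_rhs => rw [← pre_id q]
  rfl

theorem pre_tooth_append {w : VEdge C} {M M' N a b e : C} (m : M' ⟶ M) (f : M ⊗ a ⟶ N ⊗ b)
    (q : Elt w N e) : pre m (append (tooth f) q) = append (tooth (m ▷ a ≫ f)) q := by
  rw [tooth_append, tooth_append]
  change cons ((Step.bullet (𝟙 (M ⊗ a))).pre _ m) (cons (Step.circ f) q) = _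
  rw [Step.pre_bullet, Category.comp_id,
    ← Step.pre_circ, ← pre_cons, ← cons_post_left, Step.post_bullet, Category.id_comp]

theorem tooth_append_surj {w : VEdge C} {c a b e : C} (p : Elt (bullet a * circ b * w) c e) :
    ∃ (N : C) (f : c ⊗ a ⟶ N ⊗ b) (q : Elt w N e), p = append (tooth f) q := by
  obtain ⟨d, s, p, rfl⟩ := cons_surj (w := circ b * w) p
  obtain ⟨N, t, q, rfl⟩ := cons_surj p
  obtain ⟨f, hf⟩ := s.bullet_surj
  obtain ⟨g, hg⟩ := t.circ_surj
  refine ⟨N, f ≫ g, q, ?_⟩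
  rw [tooth_append, ← Step.pre_circ, ← pre_cons, ← cons_post_left, Step.post_bullet,
    Category.id_comp, hf, hg]

/-- The object between the receiving and the sending step is eliminated by co-Yoneda: the two steps
matter only through their composite `c ⊗ a ⟶ N ⊗ b`. The relation that remains is sliding along `N`.
-/
theorem exists_lift_tooth {T : Type*} {w : VEdge C} {c a b e : C}
    (F : ∀ {N : C}, (c ⊗ a ⟶ N ⊗ b) → Elt w N e → T)
    (hF : ∀ {N N' : C} (f : c ⊗ a ⟶ N ⊗ b) (m : N ⟶ N') (q : Elt w N' e),
      F (f ≫ m ▷ b) q = F f (pre m q)) :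
    ∃ L : Elt (bullet a * circ b * w) c e → T,
      ∀ {N : C} (f : c ⊗ a ⟶ N ⊗ b) (q : Elt w N e), L (append (tooth f) q) = F f q := by
  let L₁ {d : C} (s : c ⊗ a ⟶ d) : Elt (circ b * w) d e → T :=
    liftCons (fun {N} (t : d ⟶ N ⊗ b) q => F (s ≫ t) q) fun {N N'} (t : d ⟶ N ⊗ b) m q =>
      (congrArg (fun f => F f q) (Category.assoc s t (m ▷ b)).symm).trans (hF (s ≫ t) m q)
  refine ⟨liftCons (w := circ b * w) (fun {d} (s : c ⊗ a ⟶ d) p => L₁ s p)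
    fun {d d'} (s : c ⊗ a ⟶ d) m p => ?_, fun {N} f q => ?_⟩
  · obtain ⟨N, t, q, rfl⟩ := cons_surj p
    exact congrArg (fun f => F f q) (Category.assoc s m t)
  · rw [tooth_append]
    exact congrArg (fun f => F f q) (Category.id_comp f)

end Elt

/-- The element given by a sequence of teeth. -/
def teethElt : ∀ (n : ℕ) (A B : Fin n → C) (P : ℕ → C)
    (_ : ∀ i : Fin n, P (i : ℕ) ⊗ A i ⟶ P ((i : ℕ) + 1) ⊗ B i), Elt (altWord n A B) (P 0) (P n)
  | 0, _, _, P, _ => .nil (𝟙 (P 0))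
  | n + 1, A, B, P, f =>
    (Elt.tooth (f 0)).append
      (teethElt n (fun i => A i.succ) (fun i => B i.succ) (fun j => P (j + 1))
        (fun i => f i.succ))

/-- The element that represents a cell whose left boundary is trivial. -/
noncomputable def PreCell.eval {a b : C} {y : VEdge C} (α : PreCell C 1 a b y) :
    Elt y (𝟙_ C ⊗ a) (𝟙_ C ⊗ b) :=
  α.interp.app (.nil (𝟙 (𝟙_ C)))

/-- The identity of the unit is itself appended to itself, so evaluation turns vertical composition
into `append`. -/
theorem eval_vcomp {a b c : C} {y z : VEdge C} (α : PreCell C 1 a b y) (β : PreCell C 1 b c z) :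
    PreCell.eval (α.vcomp β : PreCell C (1 * 1) a c (y * z)) = α.eval.append β.eval := by
  have h := Transf.vcomp_append α.interp β.interp (.nil (𝟙 (𝟙_ C))) (.nil (𝟙 (𝟙_ C)))
  rwa [Elt.nil_append, Elt.pre_id] at h

variable [StrictMonoidal C]

theorem CellEq.eval_same {a b a' b' : C} {y y' : VEdge C} {α : PreCell C 1 a b y}
    {α' : PreCell C 1 a' b' y'} (h : α ≈ᶜ α') : α.eval ≈ᵉ α'.eval :=
  h.interp_same.2 _ _ .refl

theorem eval_gen {a b : C} (f : a ⟶ b) : (PreCell.gen f).eval ≈ᵉ Elt.nil f := by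
  refine .of_eq_pre_post (.leftUnitor_hom a) (.leftUnitor_inv b) ?_
  change Elt.nil (𝟙 (𝟙_ C) ⊗ₘ f) = _
  simp [Elt.post_nil, Elt.pre_nil]

theorem eval_vid_hcomp {a b c : C} {y : VEdge C} (α : PreCell C 1 a b y) :
    ((PreCell.vid c).hcomp α).eval ≈ᵉ α.interp.app (.nil (𝟙 c)) :=
  (Transf.hcomp_app _ _ _).trans ((eval_gen (𝟙 c)).app α.interp)

theorem eval_inCell (c a : C) :
    (inCell c a).eval ≈ᵉ Elt.single (Step.bullet (𝟙 (c ⊗ a))) (𝟙 (c ⊗ a)) := by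
  refine (inCell_cellEq c a).eval_same.trans ((eval_vid_hcomp _).trans ?_)
  refine .trans (.of_eq ?_) (.pre (.rightUnitor_hom c) _)
  rw [Elt.pre_single, Step.pre_bullet]
  change Elt.single (Step.bullet (((ρ_ c).hom ≫ 𝟙 c) ▷ a)) (𝟙 (c ⊗ a)) = _
  simp

theorem eval_outCell (c a : C) :
    (outCell c a).eval ≈ᵉ Elt.single (Step.circ (𝟙 (c ⊗ a))) (𝟙 c) := by
  refine (outCell_cellEq c a).eval_same.trans ((eval_vid_hcomp _).trans ?_)
  refine .trans (.of_eq ?_) (.post (.rightUnitor_inv c) _)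
  rw [Elt.post_single]
  change Elt.single (Step.circ (𝟙 c ▷ a)) (ρ_ c).inv = _
  simp

theorem eval_toothPre {M N a b : C} (f : M ⊗ a ⟶ N ⊗ b) : (toothPre f).eval ≈ᵉ Elt.tooth f := by
  let α : PreCell C 1 M (N ⊗ b) (bullet a) := (inCell M a).vcomp (.gen f)
  let β : PreCell C 1 M N (bullet a * circ b) := α.vcomp (outCell N b)
  have h : toothPre f ≈ᶜ β := toothPre_cellEq f
  refine h.eval_same.trans ((Elt.Same.of_eq (eval_vcomp α (outCell N b))).trans ?_)
  refine (((Elt.Same.of_eq (eval_vcomp (inCell M a) (.gen f))).trans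
    ((eval_inCell M a).append (eval_gen f))).append (eval_outCell N b)).trans ?_
  refine (Elt.Same.append_assoc _ _ _).trans (.of_eq ?_)
  rw [Elt.nil_append, Elt.pre_single, Step.pre_circ, Category.comp_id]
  exact congrArg (Elt.cons (w := circ b) (Step.bullet (𝟙 (M ⊗ a))))
    (Elt.pre_id (Elt.single (Step.circ f) (𝟙 N)))

theorem eval_teethPre : ∀ (n : ℕ) (A B : Fin n → C) (P : ℕ → C)
    (f : ∀ i : Fin n, P (i : ℕ) ⊗ A i ⟶ P ((i : ℕ) + 1) ⊗ B i),
    (teethPre n A B P f).eval ≈ᵉ teethElt n A B P f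
  | 0, _, _, P, _ => eval_gen (𝟙 (P 0))
  | n + 1, A, B, P, f => by
    refine (Elt.Same.of_eq (eval_vcomp (toothPre (f 0)) _)).trans ?_
    exact (eval_toothPre (f 0)).append (eval_teethPre n _ _ _ _)

end

/-! ### Recovering the sliding class from the evaluation -/

section

variable {C : Type u} [Category.{v} C] [MonoidalCategory C]

local infix:50 " ≈ᶜ " => CellEq
local infix:50 " ≈ᵉ " => Elt.Same

namespace FromTuple

/-- Composition with a morphism at the start. -/
def pre {k : ℕ} {A B : Fin (k + 1) → C} {c c' : C} {M N : Fin k → C} (h : c' ⟶ c)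
    (f : FromTuple A B c M N) : FromTuple A B c' M N :=
  fun i => Fin.cases (motive := fun i : Fin (k + 1) =>
    startObj c' M (i : ℕ) ⊗ A i ⟶ padObj N (i : ℕ) ⊗ B i) (h ▷ A 0 ≫ f 0) (fun i => f i.succ) i

/-- The contravariant action on the domains other than the first one. -/
def precomp {k : ℕ} {A B : Fin (k + 1) → C} {c : C} {M M' N : Fin k → C} (m : ∀ i, M i ⟶ M' i)
    (f : FromTuple A B c M' N) : FromTuple A B c M N :=
  fun i => Fin.cases (motive := fun i : Fin (k + 1) =>
    startObj c M (i : ℕ) ⊗ A i ⟶ padObj N (i : ℕ) ⊗ B i) (f 0)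
      (fun i => padMap m i ▷ A i.succ ≫ f i.succ) i

/-- The covariant action on the codomains. -/
def postcomp {k : ℕ} {A B : Fin (k + 1) → C} {c : C} {M N N' : Fin k → C}
    (f : FromTuple A B c M N) (m : ∀ i, N i ⟶ N' i) : FromTuple A B c M N' :=
  fun i => f i ≫ padMap m i ▷ B i

/-- The sliding relation on tuples that start at `c`. -/
inductive Slide {k : ℕ} (A B : Fin (k + 1) → C) (c : C) :
    (Σ M : Fin k → C, FromTuple A B c M M) → (Σ M : Fin k → C, FromTuple A B c M M) → Prop
  | slide {M N : Fin k → C} (m : ∀ i, M i ⟶ N i) (f : FromTuple A B c N M) :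
      Slide A B c ⟨N, f.postcomp m⟩ ⟨M, f.precomp m⟩

/-- The classes of tuples under the sliding relation. -/
def Classes {k : ℕ} (A B : Fin (k + 1) → C) (c : C) : Type (max u v) := Quot (Slide A B c)

/-- The class of a tuple. -/
def toClass {k : ℕ} {A B : Fin (k + 1) → C} {c : C} {M : Fin k → C} (f : FromTuple A B c M M) :
    Classes A B c :=
  Quot.mk _ ⟨M, f⟩

theorem toClass_postcomp {k : ℕ} {A B : Fin (k + 1) → C} {c : C} {M N : Fin k → C}
    (m : ∀ i, M i ⟶ N i) (f : FromTuple A B c N M) :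
    (f.postcomp m).toClass = (f.precomp m).toClass :=
  Quot.sound (.slide m f)

theorem pre_postcomp {k : ℕ} {A B : Fin (k + 1) → C} {c c' : C} {M N N' : Fin k → C} (h : c' ⟶ c)
    (f : FromTuple A B c M N) (m : ∀ i, N i ⟶ N' i) :
    (f.postcomp m).pre h = (f.pre h).postcomp m := by
  funext i
  cases i using Fin.cases with
  | zero => exact (Category.assoc _ _ _).symm
  | succ i => rfl

theorem pre_precomp {k : ℕ} {A B : Fin (k + 1) → C} {c c' : C} {M M' N : Fin k → C} (h : c' ⟶ c)
    (f : FromTuple A B c M' N) (m : ∀ i, M i ⟶ M' i) :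
    (f.precomp m).pre h = (f.pre h).precomp m := by
  funext i
  cases i using Fin.cases <;> rfl

theorem pre_single {A B : Fin 1 → C} {c c' : C} {M N : Fin 0 → C} (h : c' ⟶ c)
    (f : c ⊗ A 0 ⟶ 𝟙_ C ⊗ B 0) :
    (single f : FromTuple A B c M N).pre h = single (h ▷ A 0 ≫ f) := by
  funext i
  cases i using Fin.cases with
  | zero => rfl
  | succ i => exact i.elim0

theorem pre_cons {k : ℕ} {A B : Fin (k + 2) → C} {c c' N N' : C} {M M' : Fin k → C} (h : c' ⟶ c)
    (f : c ⊗ A 0 ⟶ N' ⊗ B 0) (t : FromTuple (fun i => A i.succ) (fun i => B i.succ) N M M') :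
    (cons f t).pre h = cons (h ▷ A 0 ≫ f) t := by
  funext i
  cases i using Fin.cases <;> rfl

/-- A slide of the tail is a slide of the whole tuple with an identity at the first memory object.
-/
theorem cons_postcomp {k : ℕ} {A B : Fin (k + 2) → C} {c N : C} {L M M' : Fin k → C}
    (f : c ⊗ A 0 ⟶ N ⊗ B 0) (t : FromTuple (fun i => A i.succ) (fun i => B i.succ) N L M)
    (m : ∀ i, M i ⟶ M' i) :
    cons f (t.postcomp m) = (cons f t).postcomp (N' := (Fin.cons N M' : Fin (k + 1) → C))
      (fun i => Fin.cases (motive := fun i : Fin (k + 1) =>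
        (Fin.cons N M : Fin (k + 1) → C) i ⟶ (Fin.cons N M' : Fin (k + 1) → C) i) (𝟙 N) m i) := by
  funext i
  cases i using Fin.cases with
  | zero =>
    change f = f ≫ 𝟙 N ▷ B 0
    simp
  | succ i => rfl

theorem cons_precomp {k : ℕ} {A B : Fin (k + 2) → C} {c N : C} {M M' L : Fin k → C}
    (f : c ⊗ A 0 ⟶ N ⊗ B 0) (t : FromTuple (fun i => A i.succ) (fun i => B i.succ) N M' L)
    (m : ∀ i, M i ⟶ M' i) :
    cons f (t.precomp m) = (cons f t).precomp (M := (Fin.cons N M : Fin (k + 1) → C))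
      (fun i => Fin.cases (motive := fun i : Fin (k + 1) =>
        (Fin.cons N M : Fin (k + 1) → C) i ⟶ (Fin.cons N M' : Fin (k + 1) → C) i) (𝟙 N) m i) := by
  funext i
  cases i using Fin.cases with
  | zero => rfl
  | succ i =>
    cases i using Fin.cases with
    | zero =>
      change t 0 = 𝟙 N ▷ A 1 ≫ t 0
      rw [id_whiskerRight]
      exact (Category.id_comp (t 0)).symm
    | succ i => rfl

/-- The slide whose only nontrivial component is `m`, at the first memory object. -/
theorem toClass_cons_comp_whiskerRight {k : ℕ} {A B : Fin (k + 2) → C} {c N N' : C}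
    {M : Fin k → C} (f : c ⊗ A 0 ⟶ N ⊗ B 0) (m : N ⟶ N')
    (t : FromTuple (fun i => A i.succ) (fun i => B i.succ) N' M M) :
    (cons (f ≫ m ▷ B 0) t).toClass = (cons f (t.pre m)).toClass := by
  let m' : ∀ i, (Fin.cons N M : Fin (k + 1) → C) i ⟶ (Fin.cons N' M : Fin (k + 1) → C) i :=
    fun i => Fin.cases (motive := fun i : Fin (k + 1) =>
      (Fin.cons N M : Fin (k + 1) → C) i ⟶ (Fin.cons N' M : Fin (k + 1) → C) i) m
        (fun i => 𝟙 (M i)) i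
  have h := toClass_postcomp m' (cons f t)
  have h₁ : (cons f t).postcomp m' = cons (f ≫ m ▷ B 0) t := by
    funext i
    cases i using Fin.cases with
    | zero => rfl
    | succ i =>
      change t i ≫ padMap (fun i => 𝟙 (M i)) i ▷ B i.succ = t i
      rw [padMap_id, id_whiskerRight]
      exact Category.comp_id (t i)
  have h₂ : (cons f t).precomp m' = cons f (t.pre m) := by
    funext i
    cases i using Fin.cases with
    | zero => rfl
    | succ i =>
      cases i using Fin.cases with
      | zero => rfl
      | succ i =>
        change padMap (fun i => 𝟙 (M i)) i ▷ A i.succ.succ ≫ t i.succ = t i.succ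
        rw [padMap_id, id_whiskerRight]
        exact Category.id_comp (t i.succ)
  rwa [h₁, h₂] at h

namespace Classes

/-- Composition with a morphism at the start. -/
def pre {k : ℕ} {A B : Fin (k + 1) → C} {c c' : C} (h : c' ⟶ c) :
    Classes A B c → Classes A B c' :=
  Quot.lift (fun f => (f.2.pre h).toClass) fun _ _ r => by
    cases r with
    | slide m f =>
      change ((f.postcomp m).pre h).toClass = ((f.precomp m).pre h).toClass
      rw [pre_postcomp, pre_precomp, toClass_postcomp]

/-- Prepend a morphism to a class of tuples. -/
def cons {k : ℕ} {A B : Fin (k + 2) → C} {c N : C} (f : c ⊗ A 0 ⟶ N ⊗ B 0) :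
    Classes (fun i => A i.succ) (fun i => B i.succ) N → Classes A B c :=
  Quot.lift (fun t => (FromTuple.cons f t.2).toClass) fun _ _ r => by
    cases r with
    | slide m t =>
      change (FromTuple.cons f (t.postcomp m)).toClass = (FromTuple.cons f (t.precomp m)).toClass
      rw [cons_postcomp, cons_precomp, toClass_postcomp]

theorem pre_cons {k : ℕ} {A B : Fin (k + 2) → C} {c c' N : C} (h : c' ⟶ c)
    (f : c ⊗ A 0 ⟶ N ⊗ B 0) (q : Classes (fun i => A i.succ) (fun i => B i.succ) N) :
    (cons f q).pre h = cons (h ▷ A 0 ≫ f) q := by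
  induction q using Quot.ind with
  | _ t => exact congrArg toClass (FromTuple.pre_cons h f t.2)

theorem cons_comp_whiskerRight {k : ℕ} {A B : Fin (k + 2) → C} {c N N' : C}
    (f : c ⊗ A 0 ⟶ N ⊗ B 0) (m : N ⟶ N')
    (q : Classes (fun i => A i.succ) (fun i => B i.succ) N') :
    cons (f ≫ m ▷ B 0) q = cons f (q.pre m) := by
  induction q using Quot.ind with
  | _ t => exact toClass_cons_comp_whiskerRight f m t.2

end Classes

theorem exists_eq_single {A B : Fin 1 → C} {c : C} {M N : Fin 0 → C} (f : FromTuple A B c M N) :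
    ∃ g, f = single g := by
  refine ⟨f 0, funext fun i => ?_⟩
  cases i using Fin.cases with
  | zero => rfl
  | succ i => exact i.elim0

theorem exists_eq_cons {k : ℕ} {A B : Fin (k + 2) → C} {c N N' : C} {M M' : Fin k → C}
    (f : FromTuple A B c (Fin.cons N M : Fin (k + 1) → C) (Fin.cons N' M' : Fin (k + 1) → C)) :
    ∃ g t, f = cons g t := by
  refine ⟨f 0, fun i => f i.succ, funext fun i => ?_⟩
  cases i using Fin.cases <;> rfl

/-- The element given by a tuple. -/
def elt {k : ℕ} {A B : Fin (k + 1) → C} {c : C} {M : Fin k → C} (f : FromTuple A B c M M) :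
    Elt (altWord (k + 1) A B) c (𝟙_ C) :=
  (teethElt (k + 1) A B (startObj c M) f).post (eqToHom (padObj_last M))

theorem elt_single {A B : Fin 1 → C} {c : C} {M : Fin 0 → C} (f : c ⊗ A 0 ⟶ 𝟙_ C ⊗ B 0) :
    (single f : FromTuple A B c M M).elt = (Elt.tooth f).append (.nil (𝟙 (𝟙_ C))) :=
  Elt.post_id _

theorem elt_cons {k : ℕ} {A B : Fin (k + 2) → C} {c N : C} {M : Fin k → C}
    (f : c ⊗ A 0 ⟶ N ⊗ B 0) (t : FromTuple (fun i => A i.succ) (fun i => B i.succ) N M M) :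
    (cons f t).elt = (Elt.tooth f).append t.elt :=
  Elt.append_post _ _ _

/-- `Φ` retracts `elt` onto sliding classes and is built tooth by tooth with
`Elt.exists_lift_tooth`. Its compatibility with `pre` is carried along because it is the sliding
condition required when the next tooth is prepended. -/
theorem exists_elt_to_classes : ∀ {k : ℕ} (A B : Fin (k + 1) → C),
    ∃ Φ : ∀ {c : C}, Elt (altWord (k + 1) A B) c (𝟙_ C) → Classes A B c,
      (∀ {c c' : C} (h : c' ⟶ c) (p : Elt (altWord (k + 1) A B) c (𝟙_ C)),
        Φ (p.pre h) = (Φ p).pre h) ∧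
      ∀ {c : C} {M : Fin k → C} (f : FromTuple A B c M M), Φ f.elt = f.toClass
  | 0, A, B => by
    have h (c : C) := Elt.exists_lift_tooth (w := 1) (c := c) (a := A 0) (b := B 0) (e := 𝟙_ C)
      -- After the last tooth, `q` is a morphism into the unit, and it is absorbed into that tooth.
      (T := Classes A B c) (fun f q => toClass (M := Fin.elim0) (single (f ≫ q.down ▷ B 0)))
      (fun f m q => by
        obtain ⟨g, rfl⟩ := q.nil_surj
        rw [Elt.pre_nil, Elt.down_nil, Elt.down_nil, Category.assoc, comp_whiskerRight])
    choose Φ hΦ using h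
    refine ⟨fun {c} => Φ c, fun {c c'} h p => ?_, fun {c M} f => ?_⟩
    · obtain ⟨N, f, q, rfl⟩ := Elt.tooth_append_surj (w := 1) p
      refine (congrArg (Φ c') (Elt.pre_tooth_append h f q)).trans ?_
      refine (hΦ c' _ _).trans (.trans ?_ (congrArg (Classes.pre h) (hΦ c f q)).symm)
      rw [Category.assoc, ← pre_single]
      rfl
    · obtain ⟨g, rfl⟩ := f.exists_eq_single
      obtain rfl : M = Fin.elim0 := Subsingleton.elim _ _
      refine (congrArg (Φ c) (elt_single g)).trans ((hΦ c _ _).trans ?_)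
      rw [Elt.down_nil, id_whiskerRight, Category.comp_id]
  | k + 1, A, B => by
    obtain ⟨Ψ, hΨ, hΨ'⟩ := exists_elt_to_classes (fun i => A i.succ) (fun i => B i.succ)
    have h (c : C) := Elt.exists_lift_tooth (c := c) (a := A 0) (b := B 0) (e := 𝟙_ C)
      (T := Classes A B c) (fun f q => Classes.cons f (Ψ q))
      (fun f m q => by rw [Classes.cons_comp_whiskerRight, hΨ])
    choose Φ hΦ using h
    refine ⟨fun {c} => Φ c, fun {c c'} h p => ?_, fun {c M} f => ?_⟩
    · obtain ⟨N, f, q, rfl⟩ := Elt.tooth_append_surj p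
      refine (congrArg (Φ c') (Elt.pre_tooth_append h f q)).trans ?_
      refine (hΦ c' _ _).trans (.trans ?_ (congrArg (Classes.pre h) (hΦ c f q)).symm)
      rw [← Classes.pre_cons]
    · obtain ⟨N, M', rfl⟩ : ∃ N M', M = (Fin.cons N M' : Fin (k + 1) → C) :=
        ⟨M 0, fun i => M i.succ, (Fin.cons_self_tail M).symm⟩
      obtain ⟨g, t, rfl⟩ := f.exists_eq_cons
      refine (congrArg (Φ c) (elt_cons g t)).trans ((hΦ c _ _).trans ?_)
      rw [hΨ']
      rfl

theorem eqvGen_slide_of_elt_eq {k : ℕ} {A B : Fin (k + 1) → C} {c : C} {M N : Fin k → C}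
    {f : FromTuple A B c M M} {g : FromTuple A B c N N} (h : f.elt = g.elt) :
    Relation.EqvGen (Slide A B c) ⟨M, f⟩ ⟨N, g⟩ := by
  obtain ⟨Φ, -, hΦ⟩ := exists_elt_to_classes A B
  exact Quot.eqvGen_exact ((hΦ f).symm.trans ((congrArg Φ h).trans (hΦ g)))

theorem eqvGen_slide_toTuple {k : ℕ} {A B : Fin (k + 1) → C}
    {s t : Σ M : Fin k → C, FromTuple A B (𝟙_ C) M M}
    (h : Relation.EqvGen (Slide A B (𝟙_ C)) s t) :
    Relation.EqvGen (FreeCornering.Slide A B) ⟨s.1, s.2.toTuple⟩ ⟨t.1, t.2.toTuple⟩ := by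
  induction h with
  | rel _ _ h =>
    cases h with
    | slide m f =>
      rename_i M N
      have h₁ : (f.postcomp m).toTuple = f.toTuple.postcomp m := by
        funext i
        cases i using Fin.cases <;> rfl
      have h₂ : (f.precomp m).toTuple = f.toTuple.precomp m := by
        funext i
        cases i using Fin.cases with
        | zero =>
          change f 0 = 𝟙 (𝟙_ C) ▷ A 0 ≫ f 0
          rw [id_whiskerRight]
          exact (Category.id_comp (f 0)).symm
        | succ i => rfl
      dsimp only
      rw [h₁, h₂]
      exact .rel _ _ (.slide m f.toTuple)
  | refl => exact .refl _
  | symm _ _ _ ih => exact .symm _ _ ih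
  | trans _ _ _ _ _ ih ih' => exact .trans _ _ _ ih ih'

theorem toTuple_surj {k : ℕ} {A B : Fin (k + 1) → C} {M N : Fin k → C} (f : Tuple A B M N) :
    ∃ g : FromTuple A B (𝟙_ C) M N, g.toTuple = f := by
  refine ⟨fun i => Fin.cases (motive := fun i : Fin (k + 1) =>
    startObj (𝟙_ C) M (i : ℕ) ⊗ A i ⟶ padObj N (i : ℕ) ⊗ B i) (f 0) (fun i => f i.succ) i, ?_⟩
  funext i
  cases i using Fin.cases <;> rfl

theorem eval_teethPre [StrictMonoidal C] {k : ℕ} {A B : Fin (k + 1) → C} {c : C} {M : Fin k → C}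
    (f : FromTuple A B c M M) : f.teethPre.eval ≈ᵉ f.elt :=
  (FreeCornering.eval_teethPre _ _ _ _ _).trans (Elt.Same.post ⟨_, rfl⟩ _).symm

end FromTuple

/-! ### Comparison of the coend with the cells -/

theorem coend_ι_postcomp {k : ℕ} {A B : Fin (k + 1) → C} {M N : Fin k → C} (m : M ⟶ N)
    (f : Tuple A B N M) :
    coend.ι (tupleFunctor A B) N (ULift.up (f.postcomp m)) =
      coend.ι (tupleFunctor A B) M (ULift.up (f.precomp m)) :=
  (ConcreteCategory.congr_hom (coend.condition (tupleFunctor A B) m)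
    (ULift.up f : ULift.{u} (Tuple A B N M))).symm

theorem coend_ι_eq_of_eqvGen {k : ℕ} {A B : Fin (k + 1) → C}
    {s t : Σ M : Fin k → C, Tuple A B M M} (h : Relation.EqvGen (Slide A B) s t) :
    coend.ι (tupleFunctor A B) s.1 (ULift.up s.2) =
      coend.ι (tupleFunctor A B) t.1 (ULift.up t.2) := by
  induction h with
  | rel _ _ h =>
    cases h with
    | slide m f => exact coend_ι_postcomp m f
  | refl => rfl
  | symm _ _ _ ih => exact ih.symm
  | trans _ _ _ _ _ ih ih' => exact ih.trans ih'

/-- Only the universal property of the coend is used: the predicate of being hit by some `coend.ι`,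
as a map to lifted propositions, agrees with the constant map `True` after each `coend.ι`, hence
everywhere. -/
theorem coend_ι_surj {k : ℕ} {A B : Fin (k + 1) → C} (t : coend (tupleFunctor A B)) :
    ∃ (M : Fin k → C) (f : Tuple A B M M), coend.ι (tupleFunctor A B) M (ULift.up f) = t := by
  let φ : coend (tupleFunctor A B) ⟶ ULift.{max u v} Prop := TypeCat.ofHom fun t =>
    ⟨∃ (M : Fin k → C) (f : Tuple A B M M), coend.ι (tupleFunctor A B) M (ULift.up f) = t⟩
  have h : φ = TypeCat.ofHom fun _ => ⟨True⟩ := coend.hom_ext fun M => by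
    ext f
    exact iff_true_intro ⟨M, f.down, rfl⟩
  exact of_eq_true (congrArg ULift.down (ConcreteCategory.congr_hom h t))

variable [StrictMonoidal C]

theorem eqvGen_slide_of_comb_eq {k : ℕ} {A B : Fin (k + 1) → C} {M N : Fin k → C}
    {f : Tuple A B M M} {g : Tuple A B N N} (h : comb f = comb g) :
    Relation.EqvGen (Slide A B) ⟨M, f⟩ ⟨N, g⟩ := by
  obtain ⟨f, rfl⟩ := FromTuple.toTuple_surj f
  obtain ⟨g, rfl⟩ := FromTuple.toTuple_surj g
  rw [comb_eq_comb_iff] at h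
  have h' : f.teethPre ≈ᶜ g.teethPre :=
    (FromTuple.combPre_toTuple f).symm.trans (h.trans (FromTuple.combPre_toTuple g))
  exact FromTuple.eqvGen_slide_toTuple (FromTuple.eqvGen_slide_of_elt_eq
    (f.eval_teethPre.symm.trans (h'.eval_same.trans g.eval_teethPre)).eq)

/-- The map from the coend to the cells. -/
noncomputable def coendToCell {k : ℕ} (A B : Fin (k + 1) → C) :
    coend (tupleFunctor A B) ⟶ Cell C 1 (𝟙_ C) (𝟙_ C) (altWord (k + 1) A B) :=
  coend.desc (fun _ => TypeCat.ofHom fun f => comb f.down) fun M N m => by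
    ext f
    exact (comb_postcomp m f.down).symm

theorem coendToCell_ι {k : ℕ} {A B : Fin (k + 1) → C} {M : Fin k → C} (f : Tuple A B M M) :
    coendToCell A B (coend.ι (tupleFunctor A B) M (ULift.up f)) = comb f :=
  ConcreteCategory.congr_hom (coend.ι_desc (F := tupleFunctor A B) _ _ M)
    (ULift.up f : ULift.{u} (Tuple A B M M))

end

end FreeCornering

theorem lemma2 {C : Type u} [Category.{v} C] [MonoidalCategory C] [StrictMonoidal C]
    (k : ℕ) (A B : Fin (k + 1) → C) :
    (∃ e : coend (FreeCornering.tupleFunctor A B) ≃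
        FreeCornering.Cell C 1 (𝟙_ C) (𝟙_ C) (FreeCornering.altWord (k + 1) A B),
      ∀ (M : Fin k → C) (f : FreeCornering.Tuple A B M M),
        e (coend.ι (FreeCornering.tupleFunctor A B) M (ULift.up f)) = FreeCornering.comb f) ∧
    (∀ c : FreeCornering.Cell C 1 (𝟙_ C) (𝟙_ C) (FreeCornering.altWord (k + 1) A B),
      ∃ (M : Fin k → C) (f : FreeCornering.Tuple A B M M), FreeCornering.comb f = c) ∧
    (∀ (M N : Fin k → C) (f : FreeCornering.Tuple A B M M) (g : FreeCornering.Tuple A B N N),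
      FreeCornering.comb f = FreeCornering.comb g ↔
        Relation.EqvGen (FreeCornering.Slide A B) ⟨M, f⟩ ⟨N, g⟩) := by
  refine ⟨⟨Equiv.ofBijective (FreeCornering.coendToCell A B) ⟨fun s t h => ?_, fun c => ?_⟩,
    fun M f => FreeCornering.coendToCell_ι f⟩, FreeCornering.exists_comb_eq,
    fun M N f g => ⟨FreeCornering.eqvGen_slide_of_comb_eq, FreeCornering.comb_eq_of_eqvGen⟩⟩
  · obtain ⟨M, f, rfl⟩ := FreeCornering.coend_ι_surj s
    obtain ⟨N, g, rfl⟩ := FreeCornering.coend_ι_surj t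
    rw [FreeCornering.coendToCell_ι, FreeCornering.coendToCell_ι] at h
    exact FreeCornering.coend_ι_eq_of_eqvGen (FreeCornering.eqvGen_slide_of_comb_eq h)
  · obtain ⟨M, f, rfl⟩ := FreeCornering.exists_comb_eq c
    exact ⟨_, FreeCornering.coendToCell_ι f⟩
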